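/- **Theorem B.** Let $k$ be an algebraically closed field. Let $\mathbb{G}$ be the smallest class of groups (closed under isomorphism) that contains all cyclic groups, finite or infinite, and such that $G\amalg H$ (free product) and $G\times H$ belong to $\mathbb{G}$ whenever $G$ and $H$ do. Let $G_1,\dots,G_n\in\mathbb{G}$. Then there exist a basic, connected, finite-dimensional $k$-algebra $A$ that is triangular, i.e. whose quiver $Q_A$ (finite and connected) has no oriented cycles, and presentations $\nu_i\colon kQ_A\to A$ with kernels $I_i$, so that $A\simeq kQ_A/I_i$, for $i\in\{1,\dots,n\}$, such that $\pi_1(Q_A,I_i)\simeq G_i$ for every $i$. Here $kQ$ denotes the path algebra of a finite quiver $Q$, and $F$ is its two-sided ideal generated by the arrows. A two-sided ideal $I$ of $kQ$ is *admissible* if $F^m\subseteq I\subseteq F^2$ for some $m\ge 2$. A *presentation* of $A$ is a surjective morphism of $k$-algebras $kQ_A\to A$ whose kernel is admissible. A *minimal relation* of $I$ is an element $\sum_{i=1}^m\lambda_iw_i\in I$ with $m\ge2$, $\lambda_i\in k\setminus\{0\}$ and $w_1,\dots,w_m$ distinct paths with a common source and a common target, such that $\sum_{i\in J}\lambda_iw_i\notin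 I$ for every nonempty proper subset $J\subset\{1,\dots,m\}$. A *walk* is a composable sequence of arrows and formal inverses of arrows. *Homotopy* is the smallest equivalence relation $\sim$ on walks, compatible with composition, such that $\alpha\alpha^{-1}\sim e_x$ and $\alpha^{-1}\alpha\sim e_y$ for every arrow $\alpha\colon x\to y$, and such that $w_i\sim w_j$ for any two paths $w_i,w_j$ that occur in a common minimal relation of $I$. The fundamental group $\pi_1(Q,I)$ is the group of homotopy classes of closed walks at a vertex $x$; for connected $Q$ it does not depend on $x$ up to isomorphism. -/

import Mathlib

universe u v w

noncomputable section

/-! ### The path algebra of a quiver -/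

/-- The underlying space of the path algebra `kQ`: the `k`-vector space whose basis is the set of
all paths of the quiver, including the stationary paths. -/
def PathAlgebra (k : Type u) (V : Type v) [Field k] [Quiver.{w} V] : Type (max u v w) :=
  (Σ a b : V, Quiver.Path a b) →₀ k

namespace PathAlgebra

variable (k : Type u) {V : Type v} [Field k] [Quiver.{w} V]

instance : AddCommGroup (PathAlgebra k V) :=
  inferInstanceAs (AddCommGroup ((Σ a b : V, Quiver.Path a b) →₀ k))

instance : Module k (PathAlgebra k V) :=
  inferInstanceAs (Module k ((Σ a b : V, Quiver.Path a b) →₀ k))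

variable (V) in
/-- The basis of `kQ` formed by the paths. -/
def basis : Module.Basis (Σ a b : V, Quiver.Path a b) k (PathAlgebra k V) :=
  Module.Basis.ofRepr (LinearEquiv.refl k ((Σ a b : V, Quiver.Path a b) →₀ k))

/-- The basis element of `kQ` given by a path. -/
def ofPath {a b : V} (p : Quiver.Path a b) : PathAlgebra k V := basis k V ⟨a, b, p⟩

open Classical in
/-- The product of two paths in `kQ`: their composition if the first one ends where the second one
starts, and `0` otherwise. -/
def pathMul (p q : Σ a b : V, Quiver.Path a b) : PathAlgebra k V :=
  if h : q.1 = p.2.1 then ofPath k (p.2.2.comp (q.2.2.cast h rfl)) else 0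

/-- The multiplication of `kQ` as a bilinear map. -/
def mulMap : PathAlgebra k V →ₗ[k] PathAlgebra k V →ₗ[k] PathAlgebra k V :=
  (basis k V).constr k fun p => (basis k V).constr k fun q => pathMul k p q

instance : Mul (PathAlgebra k V) := ⟨fun f g => mulMap k f g⟩

variable {k}

theorem mul_def (f g : PathAlgebra k V) : f * g = mulMap k f g := rfl

theorem mulMap_ofPath {a b c d : V} (p : Quiver.Path a b) (q : Quiver.Path c d) :
    mulMap k (ofPath k p) (ofPath k q) = pathMul k ⟨a, b, p⟩ ⟨c, d, q⟩ := by
  simp only [mulMap, ofPath, Module.Basis.constr_basis]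

theorem ofPath_mul_ofPath {a b c : V} (p : Quiver.Path a b) (q : Quiver.Path b c) :
    ofPath k p * ofPath k q = ofPath k (p.comp q) := by
  rw [mul_def, mulMap_ofPath, pathMul, dif_pos rfl]
  rfl

theorem ofPath_mul_ofPath_of_ne {a b c d : V} (p : Quiver.Path a b) (q : Quiver.Path c d)
    (h : c ≠ b) : ofPath k p * ofPath k q = 0 := by
  rw [mul_def, mulMap_ofPath, pathMul, dif_neg h]

/-- Linear maps out of `kQ` that agree on all paths are equal. -/
theorem hom_ext {M : Type*} [AddCommMonoid M] [Module k M] {f g : PathAlgebra k V →ₗ[k] M}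
    (h : ∀ (a b : V) (p : Quiver.Path a b), f (ofPath k p) = g (ofPath k p)) : f = g :=
  (basis k V).ext fun ⟨a, b, p⟩ => h a b p

protected theorem mul_assoc (f g h : PathAlgebra k V) : f * g * h = f * (g * h) := by
  have e : (mulMap k (V := V)).compr₂ (mulMap k) =
      ((LinearMap.llcomp k (PathAlgebra k V) (PathAlgebra k V →ₗ[k] PathAlgebra k V)
        (PathAlgebra k V →ₗ[k] PathAlgebra k V)).flip (mulMap k)).comp
        ((LinearMap.llcomp k (PathAlgebra k V) (PathAlgebra k V)
          (PathAlgebra k V)).comp (mulMap k)) := by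
    refine hom_ext fun a b p => hom_ext fun c d q => hom_ext fun x y r => ?_
    change ofPath k p * ofPath k q * ofPath k r = ofPath k p * (ofPath k q * ofPath k r)
    by_cases h₁ : c = b
    · subst h₁
      by_cases h₂ : x = d
      · subst h₂
        simp only [ofPath_mul_ofPath, Quiver.Path.comp_assoc]
      · rw [ofPath_mul_ofPath, ofPath_mul_ofPath_of_ne _ _ h₂, ofPath_mul_ofPath_of_ne _ _ h₂,
          mul_def, map_zero]
    · rw [ofPath_mul_ofPath_of_ne _ _ h₁]
      by_cases h₂ : x = d
      · subst h₂
        rw [ofPath_mul_ofPath, ofPath_mul_ofPath_of_ne _ _ h₁, mul_def, map_zero,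
          LinearMap.zero_apply]
      · rw [ofPath_mul_ofPath_of_ne _ _ h₂]
        simp [mul_def]
  exact LinearMap.congr_fun (LinearMap.congr_fun (LinearMap.congr_fun e f) g) h

variable [Fintype V]

/-- The unit of `kQ` is the sum of all stationary paths. -/
instance : One (PathAlgebra k V) := ⟨∑ x : V, ofPath k (Quiver.Path.nil : Quiver.Path x x)⟩

theorem one_def :
    (1 : PathAlgebra k V) = ∑ x : V, ofPath k (Quiver.Path.nil : Quiver.Path x x) := rfl

protected theorem one_mul (f : PathAlgebra k V) : 1 * f = f := by
  have e : mulMap k (V := V) 1 = LinearMap.id := by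
    refine hom_ext fun a b p => ?_
    rw [one_def, map_sum, LinearMap.sum_apply, Finset.sum_eq_single a]
    · exact (ofPath_mul_ofPath _ _).trans (by rw [Quiver.Path.nil_comp]; rfl)
    · intro x _ hx
      exact ofPath_mul_ofPath_of_ne _ _ (Ne.symm hx)
    · simp
  exact LinearMap.congr_fun e f

protected theorem mul_one (f : PathAlgebra k V) : f * 1 = f := by
  have e : (mulMap k (V := V)).flip 1 = LinearMap.id := by
    refine hom_ext fun a b p => ?_
    rw [LinearMap.flip_apply, one_def, map_sum, Finset.sum_eq_single b]
    · exact (ofPath_mul_ofPath _ _).trans (by rw [Quiver.Path.comp_nil]; rfl)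
    · intro x _ hx
      exact ofPath_mul_ofPath_of_ne _ _ hx
    · simp
  exact LinearMap.congr_fun e f

instance : Ring (PathAlgebra k V) :=
  { (inferInstance : AddCommGroup (PathAlgebra k V)) with
    mul := (· * ·)
    one := 1
    mul_assoc := PathAlgebra.mul_assoc
    one_mul := PathAlgebra.one_mul
    mul_one := PathAlgebra.mul_one
    left_distrib := fun f g h => map_add (mulMap k f) g h
    right_distrib := fun f g h => LinearMap.map_add₂ (mulMap k) f g h
    zero_mul := fun f => LinearMap.map_zero₂ (mulMap k) f
    mul_zero := fun f => map_zero (mulMap k f) }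

instance : Algebra k (PathAlgebra k V) :=
  Algebra.ofModule (fun r f g => LinearMap.map_smul₂ (mulMap k) r f g)
    (fun r f g => map_smul (mulMap k f) r g)

variable (k V)

/-- The two-sided ideal `F` of `kQ` generated by the arrows. -/
def arrowIdeal : Ideal (PathAlgebra k V) :=
  (TwoSidedIdeal.span
    {f : PathAlgebra k V | ∃ (a b : V) (α : a ⟶ b), f = ofPath k α.toPath}).asIdeal

variable {k V}

/-- A two-sided ideal `I` of `kQ` is admissible if `F ^ m ⊆ I ⊆ F ^ 2` for some `m ≥ 2`. -/
structure IsAdmissible (I : Ideal (PathAlgebra k V)) : Prop where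
  isTwoSided : I.IsTwoSided
  exists_pow_le : ∃ m : ℕ, 2 ≤ m ∧ arrowIdeal k V ^ m ≤ I
  le_sq : I ≤ arrowIdeal k V ^ 2

/-- The relation `∑ λ_w w`, where `c w = λ_w` is nonzero exactly for the paths `w` (from `x` to `y`)
in the finite set `c.support`, is a minimal relation of `I`: it lies in `I`, involves at least two
paths, and none of its proper nonempty partial sums lies in `I`. -/
structure IsMinimalRelation (I : Ideal (PathAlgebra k V)) {x y : V}
    (c : Quiver.Path x y →₀ k) : Prop where
  two_le_card : 2 ≤ c.support.card
  mem : ∑ w ∈ c.support, c w • ofPath k w ∈ I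
  notMem : ∀ J : Finset (Quiver.Path x y), J ⊂ c.support → J.Nonempty →
    ∑ w ∈ J, c w • ofPath k w ∉ I

end PathAlgebra

/-! ### The fundamental group of a bound quiver -/

/-- A walk from `x` to `y`: a composable sequence of arrows and formal inverses of arrows. -/
abbrev QuiverWalk {V : Type v} [Quiver.{w} V] (x y : Quiver.Symmetrify V) : Type (max v w) :=
  Quiver.Path x y

/-- A vertex viewed as a vertex of the quiver with formal inverses of arrows added. -/
abbrev Quiver.symVertex {V : Type v} [Quiver.{w} V] (x : V) : Quiver.Symmetrify V :=
  (Quiver.Symmetrify.of (V := V)).obj x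

/-- A path viewed as a walk. -/
def Quiver.Path.toWalk {V : Type v} [Quiver.{w} V] {x y : V} (p : Quiver.Path x y) :
    QuiverWalk (Quiver.symVertex x) (Quiver.symVertex y) :=
  (Quiver.Symmetrify.of (V := V)).mapPath p

open PathAlgebra in
/-- The homotopy relation on walks of `(Q, I)`: the smallest equivalence relation with
`α α⁻¹ ∼ e_x` and `α⁻¹ α ∼ e_y` for each arrow `α : x ⟶ y`, which identifies all paths that occur in
a common minimal relation, and which is compatible with composition. -/
inductive WalkHomotopic {k : Type u} {V : Type v} [Field k] [Quiver.{w} V] [Fintype V]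
    (I : Ideal (PathAlgebra k V)) :
    ∀ {x y : Quiver.Symmetrify V}, QuiverWalk x y → QuiverWalk x y → Prop
  | refl {x y : Quiver.Symmetrify V} (p : QuiverWalk x y) : WalkHomotopic I p p
  | symm {x y : Quiver.Symmetrify V} {p q : QuiverWalk x y} :
      WalkHomotopic I p q → WalkHomotopic I q p
  | trans {x y : Quiver.Symmetrify V} {p q r : QuiverWalk x y} :
      WalkHomotopic I p q → WalkHomotopic I q r → WalkHomotopic I p r
  | arrow_inv {x y : V} (α : x ⟶ y) :
      WalkHomotopic I (x := Quiver.symVertex x) (y := Quiver.symVertex x)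
        ((Quiver.Path.nil.cons α.toPos).cons α.toNeg) Quiver.Path.nil
  | inv_arrow {x y : V} (α : x ⟶ y) :
      WalkHomotopic I (x := Quiver.symVertex y) (y := Quiver.symVertex y)
        ((Quiver.Path.nil.cons α.toNeg).cons α.toPos) Quiver.Path.nil
  | minimal {x y : V} (c : Quiver.Path x y →₀ k) (hc : IsMinimalRelation I c)
      (p q : Quiver.Path x y) (hp : p ∈ c.support) (hq : q ∈ c.support) :
      WalkHomotopic I p.toWalk q.toWalk
  | comp {x' x y y' : Quiver.Symmetrify V} (s : QuiverWalk x' x) {p q : QuiverWalk x y}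
      (t : QuiverWalk y y') :
      WalkHomotopic I p q → WalkHomotopic I ((s.comp p).comp t) ((s.comp q).comp t)

namespace WalkHomotopic

variable {k : Type u} {V : Type v} [Field k] [Quiver.{w} V] [Fintype V]
  {I : Ideal (PathAlgebra k V)}

theorem comp_left {x y z : Quiver.Symmetrify V} (s : QuiverWalk x y) {p q : QuiverWalk y z}
    (h : WalkHomotopic I p q) : WalkHomotopic I (s.comp p) (s.comp q) :=
  WalkHomotopic.comp s Quiver.Path.nil h

theorem comp_right {x y z : Quiver.Symmetrify V} {p q : QuiverWalk x y} (h : WalkHomotopic I p q)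
    (t : QuiverWalk y z) : WalkHomotopic I (p.comp t) (q.comp t) := by
  simpa only [Quiver.Path.nil_comp] using WalkHomotopic.comp Quiver.Path.nil t h

theorem comp_congr {x y z : Quiver.Symmetrify V} {p p' : QuiverWalk x y} {q q' : QuiverWalk y z}
    (h : WalkHomotopic I p p') (h' : WalkHomotopic I q q') :
    WalkHomotopic I (p.comp q) (p'.comp q') :=
  (h.comp_right q).trans (h'.comp_left p')

theorem comp_reverse {x y : Quiver.Symmetrify V} (p : QuiverWalk x y) :
    WalkHomotopic I (p.comp p.reverse) Quiver.Path.nil := by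
  induction p with
  | nil => exact WalkHomotopic.refl _
  | @cons b c p e ih =>
    have h : WalkHomotopic I ((Quiver.Path.nil.cons e).cons (Quiver.reverse e))
        (Quiver.Path.nil : QuiverWalk b b) := by
      rcases e with α | α
      · exact WalkHomotopic.arrow_inv α
      · exact WalkHomotopic.inv_arrow α
    have h' := WalkHomotopic.comp p p.reverse h
    have e' : (p.cons e).comp (p.cons e).reverse =
        (p.comp ((Quiver.Path.nil.cons e).cons (Quiver.reverse e))).comp p.reverse := by
      rw [Quiver.Path.reverse, ← Quiver.Path.comp_assoc]
      rfl
    rw [e']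
    exact h'.trans ih

theorem reverse_comp {x y : Quiver.Symmetrify V} (p : QuiverWalk x y) :
    WalkHomotopic I (p.reverse.comp p) Quiver.Path.nil := by
  simpa only [Quiver.Path.reverse_reverse] using comp_reverse (I := I) p.reverse

theorem reverse_congr {x y : Quiver.Symmetrify V} {p q : QuiverWalk x y}
    (h : WalkHomotopic I p q) : WalkHomotopic I p.reverse q.reverse := by
  have h₁ : WalkHomotopic I p.reverse (p.reverse.comp (q.comp q.reverse)) :=
    ((comp_reverse q).comp_left p.reverse).symm
  have h₂ : WalkHomotopic I (p.reverse.comp (q.comp q.reverse))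
      (p.reverse.comp (p.comp q.reverse)) := (h.symm.comp_right q.reverse).comp_left p.reverse
  have h₃ := (reverse_comp (I := I) p).comp_right q.reverse
  rw [Quiver.Path.nil_comp, Quiver.Path.comp_assoc] at h₃
  exact h₁.trans (h₂.trans h₃)

variable (I) in
/-- Homotopy of closed walks at `x`. -/
def setoid (x : Quiver.Symmetrify V) : Setoid (QuiverWalk x x) where
  r p q := WalkHomotopic I p q
  iseqv := ⟨WalkHomotopic.refl, WalkHomotopic.symm, WalkHomotopic.trans⟩

end WalkHomotopic

/-- The fundamental group `π₁(Q, I, x)`: closed walks at `x` up to homotopy. -/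
def QuiverFundamentalGroup {k : Type u} {V : Type v} [Field k] [Quiver.{w} V] [Fintype V]
    (I : Ideal (PathAlgebra k V)) (x : V) : Type (max v w) :=
  Quotient (WalkHomotopic.setoid I (Quiver.symVertex x))

/-- The product of homotopy classes is induced by the composition of walks. -/
instance {k : Type u} {V : Type v} [Field k] [Quiver.{w} V] [Fintype V]
    (I : Ideal (PathAlgebra k V)) (x : V) : Group (QuiverFundamentalGroup I x) where
  mul := Quotient.map₂ (fun p q => p.comp q) fun _ _ h _ _ h' => WalkHomotopic.comp_congr h h'
  one := Quotient.mk _ Quiver.Path.nil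
  inv := Quotient.map (fun p => p.reverse) fun _ _ h => WalkHomotopic.reverse_congr h
  mul_assoc := by
    rintro ⟨p⟩ ⟨q⟩ ⟨r⟩
    exact congrArg (Quotient.mk _) (Quiver.Path.comp_assoc p q r)
  one_mul := by
    rintro ⟨p⟩
    exact congrArg (Quotient.mk _) (Quiver.Path.nil_comp p)
  mul_one := by
    rintro ⟨p⟩
    exact congrArg (Quotient.mk _) (Quiver.Path.comp_nil p)
  inv_mul_cancel := by
    rintro ⟨p⟩
    exact Quotient.sound (WalkHomotopic.reverse_comp p)

/-! ### Algebras and their presentations -/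

/-- The quiver has finitely many arrows (its vertex set is finite by the instance), is nonempty and
its underlying graph is connected. -/
structure IsFiniteConnectedQuiver (V : Type v) [Quiver.{w} V] [Fintype V] : Prop where
  finite_hom : ∀ a b : V, Finite (a ⟶ b)
  nonempty : Nonempty V
  connected : ∀ a b : V, Nonempty (QuiverWalk (Quiver.symVertex a) (Quiver.symVertex b))

/-- The quiver has no oriented cycles (in particular no loops). -/
def IsAcyclicQuiver (V : Type v) [Quiver.{w} V] : Prop :=
  ∀ (a : V) (p : Quiver.Path a a), p.length = 0

/-- A presentation of the algebra `A`: a surjective morphism `kQ → A` of `k`-algebras whose kernel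
is an admissible ideal. -/
structure IsPresentation {k : Type u} {V : Type v} [Field k] [Quiver.{w} V] [Fintype V]
    {A : Type*} [Ring A] [Algebra k A] (ν : PathAlgebra k V →ₐ[k] A) : Prop where
  surjective : Function.Surjective ν
  admissible : PathAlgebra.IsAdmissible (RingHom.ker ν)

/-- A finite-dimensional algebra over an algebraically closed field `k` is basic if `A / rad A` is a
finite product of copies of `k`. -/
def IsBasicAlgebra (k : Type u) [Field k] (A : Type*) [Ring A] [Algebra k A] : Prop :=
  ∃ r : ℕ, Nonempty ((A ⧸ Ring.jacobson A) ≃ₐ[k] (Fin r → k))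

/-- A ring is connected if it is nonzero and its only central idempotents are `0` and `1`, that is,
it is not a product of two nonzero rings. -/
structure IsConnectedAlgebra (A : Type*) [Ring A] : Prop where
  nontrivial : Nontrivial A
  eq_zero_or_one : ∀ e : A, e * e = e → (∀ a : A, e * a = a * e) → e = 0 ∨ e = 1

/-- `A` is a basic connected finite-dimensional `k`-algebra which is triangular, with quiver `V`:
the finite connected quiver `V` of `A` has no oriented cycles. -/
structure IsTriangularAlgebra (k : Type u) [Field k] (A : Type*) [Ring A] [Algebra k A]
    (V : Type v) [Quiver.{w} V] [Fintype V] : Prop where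
  finiteDimensional : FiniteDimensional k A
  basic : IsBasicAlgebra k A
  connected : IsConnectedAlgebra A
  quiver : IsFiniteConnectedQuiver V
  acyclic : IsAcyclicQuiver V
  exists_presentation : ∃ ν : PathAlgebra k V →ₐ[k] A, IsPresentation ν

/-! ### The class of groups -/

/-- The smallest class of groups (up to isomorphism) which contains the cyclic groups and is closed
under free products and direct products of two groups. -/
inductive CyclicProductClass : (G : Type u) → [Group G] → Prop
  | cyclic (G : Type u) [Group G] (h : IsCyclic G) : CyclicProductClass G
  | coprod (G H : Type u) [Group G] [Group H] :
      CyclicProductClass G → CyclicProductClass H → CyclicProductClass (Monoid.Coprod G H)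
  | prod (G H : Type u) [Group G] [Group H] :
      CyclicProductClass G → CyclicProductClass H → CyclicProductClass (G × H)
  | congr (G H : Type u) [Group G] [Group H] (e : G ≃* H) :
      CyclicProductClass G → CyclicProductClass H

end

/-!
The groups of the class are finitely presented, and every finitely presented group `H` is presented
by a piece of a multiplication table: there are a surjection `π : Γ → H` and a finite set `T ∋ 1`
of elements of `Γ` such that `H` is generated by the elements of `T` subject to the relations
`s · t = st` for `s, t, st ∈ T` and `t = 1` for `t ∈ T ∩ ker π`. For finitely many groups, `Γ` and
`T` can be chosen in common, only `π` depending on the group.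

Let the algebra have a basis of three idempotents, two copies of `T`, and `T · T`, the product of
the two copies being that of `Γ`. Its quiver has three vertices in a row and the elements of `T` as
arrows of each of the two steps. In the obvious presentation the path `(s, t)` is sent to `st`, and
the minimal relations `(s, t) - (1, st)` impose `s · t = st` in the fundamental group. Given `π`,
send the arrow `s` of the first step to `s + 1` instead whenever `π s = 1` and `s ≠ 1`. Then the
relation becomes `(s, t) - (1, st) - (1, t)`, which in addition kills `s`. No further relations
arise, because all of this is homogeneous for the grading of the algebra by `π`.
-/

noncomputable section

/-! ### Finitely presented groups and multiplication tables -/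

theorem commute_of_closure_eq_top {G H K : Type*} [Group G] [Group H] [Group K] {f : G →* K}
    {g : H →* K} {S : Set G} {T : Set H} (hS : Subgroup.closure S = ⊤)
    (hT : Subgroup.closure T = ⊤) (h : ∀ s ∈ S, ∀ t ∈ T, Commute (f s) (g t)) (x : G) (y : H) :
    Commute (f x) (g y) := by
  have hST : S ⊆ (Subgroup.centralizer (g '' T)).comap f := fun s hs => by
    rintro _ ⟨t, ht, rfl⟩
    exact (h s hs t ht).symm
  have hx : f x ∈ Subgroup.centralizer (g '' T) :=
    (Subgroup.closure_le _).2 hST (hS ▸ Subgroup.mem_top x)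
  rw [← Subgroup.centralizer_closure, ← MonoidHom.map_closure, hT] at hx
  exact (hx (g y) ⟨y, Subgroup.mem_top y, rfl⟩).symm

open Monoid.Coprod commutatorElement in
theorem ker_toProd_eq_normalClosure {G H : Type*} [Group G] [Group H] {S : Set G}
    {T : Set H} (hS : Subgroup.closure S = ⊤) (hT : Subgroup.closure T = ⊤) :
    (toProd : Monoid.Coprod G H →* G × H).ker =
      Subgroup.normalClosure
        (Set.image2 (fun s t => ⁅(inl s : Monoid.Coprod G H), inr t⁆) S T) := by
  set N := Subgroup.normalClosure
    (Set.image2 (fun s t => ⁅(inl s : Monoid.Coprod G H), (inr t : Monoid.Coprod G H)⁆) S T)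
  have commute : ∀ (g : G) (h : H),
      Commute ((QuotientGroup.mk' N).comp inl g) ((QuotientGroup.mk' N).comp inr h) := by
    refine commute_of_closure_eq_top hS hT fun s hs t ht => ?_
    rw [← commutatorElement_eq_one_iff_commute, MonoidHom.comp_apply, MonoidHom.comp_apply,
      ← map_commutatorElement, ← MonoidHom.mem_ker, QuotientGroup.ker_mk']
    exact Subgroup.subset_normalClosure ⟨s, hs, t, ht, rfl⟩
  refine le_antisymm (fun x hx => ?_) (Subgroup.normalClosure_le_normal ?_)
  · have factor : (MonoidHom.noncommCoprod _ _ commute).comp toProd = QuotientGroup.mk' N := by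
      ext <;> simp
    rw [← QuotientGroup.ker_mk' N, MonoidHom.mem_ker, ← factor, MonoidHom.comp_apply,
      MonoidHom.mem_ker.1 hx, map_one]
  · rintro _ ⟨s, -, t, -, rfl⟩
    simp [commutatorElement_def]

theorem fg_of_isFinitelyPresented (G : Type*) [Group G] [Group.IsFinitelyPresented G] :
    Group.FG G :=
  have ⟨_, _, hf, _⟩ := Group.IsFinitelyPresented.out (G := G)
  Group.fg_of_surjective hf

theorem isFinitelyPresented_prod {G : Type*} {H : Type*} [Group G] [Group H]
    [Group.IsFinitelyPresented G] [Group.IsFinitelyPresented H] :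
    Group.IsFinitelyPresented (G × H) := by
  obtain ⟨S, hS, hSfin⟩ := Group.fg_iff.1 (fg_of_isFinitelyPresented G)
  obtain ⟨T, hT, hTfin⟩ := Group.fg_iff.1 (fg_of_isFinitelyPresented H)
  exact .of_surjective Monoid.Coprod.toProd Monoid.Coprod.toProd_surjective
    ⟨_, hSfin.image2 _ hTfin, (ker_toProd_eq_normalClosure hS hT).symm⟩

theorem isFinitelyPresented_of_isCyclic (G : Type*) [Group G] (h : IsCyclic G) :
    Group.IsFinitelyPresented G := by
  cases finite_or_infinite G
  · infer_instance
  · have e := zmodCyclicMulEquiv h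
    rw [Nat.card_eq_zero_of_infinite] at e
    exact .equiv (G := Multiplicative ℤ) e

theorem CyclicProductClass.isFinitelyPresented {G : Type v} [Group G]
    (hG : CyclicProductClass G) : Group.IsFinitelyPresented G := by
  induction hG with
  | cyclic G h => exact isFinitelyPresented_of_isCyclic G h
  | coprod G H _ _ _ _ => infer_instance
  | prod G H _ _ _ _ => exact isFinitelyPresented_prod
  | congr G H e _ _ => exact .equiv e

/-- The homomorphism `π` presents `H` by the multiplication table of `T`: the images of the elements
of `T` generate `H`, and the relations `x * y = z` between `x, y, z ∈ T` together with `x = 1` for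
`x ∈ T ∩ ker π` define `H`. The universal property is tested on the groups in one universe. -/
structure IsTablePresentation {Γ : Type*} {H : Type*} [Group Γ] [Group H] (T : Set Γ)
    (π : Γ →* H) : Prop where
  closure_image : Subgroup.closure (π '' T) = ⊤
  exists_hom : ∀ {K : Type w} [Group K] (f : Γ → K), (∀ x ∈ T, π x = 1 → f x = 1) →
    (∀ x ∈ T, ∀ y ∈ T, x * y ∈ T → f (x * y) = f x * f y) → ∃ F : H →* K, ∀ x ∈ T, F (π x) = f x

section WordBall

variable {α : Type*} [DecidableEq α]

theorem finite_norm_le [Finite α] (n : ℕ) : {x : FreeGroup α | x.norm ≤ n}.Finite :=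
  (List.finite_length_le (α × Bool) n).preimage FreeGroup.toWord_injective.injOn

theorem freeGroup_lift_eq_of_norm_le {K : Type*} [Group K] {f : FreeGroup α → K} {n : ℕ}
    (hn : 1 ≤ n) (hmul : ∀ x, x.norm ≤ n → ∀ y, y.norm ≤ n → (x * y).norm ≤ n →
      f (x * y) = f x * f y) {x : FreeGroup α} (hx : x.norm ≤ n) :
    FreeGroup.lift (fun a => f (.of a)) x = f x := by
  rw [← FreeGroup.mk_toWord (x := x)]
  change x.toWord.length ≤ n at hx
  generalize x.toWord = L at hx ⊢
  induction L with
  | nil =>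
    have h := hmul 1 (by simp) 1 (by simp) (by simp)
    rw [one_mul, left_eq_mul] at h
    exact h.symm
  | cons s L ih =>
    obtain ⟨a, b⟩ := s
    have hL : (FreeGroup.mk L).norm ≤ n :=
      FreeGroup.norm_mk_le.trans ((Nat.le_succ _).trans hx)
    have hsL : (FreeGroup.mk ((a, b) :: L)).norm ≤ n := FreeGroup.norm_mk_le.trans hx
    have ha : (FreeGroup.of a).norm ≤ n := by simpa using hn
    have ih' := ih ((Nat.le_succ _).trans hx)
    cases b with
    | true =>
      have hcons : FreeGroup.mk ((a, true) :: L) = .of a * .mk L := rfl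
      rw [hcons] at hsL ⊢
      rw [hmul _ ha _ hL hsL, map_mul, ih', FreeGroup.lift_apply_of]
    | false =>
      have hcons : FreeGroup.mk L = .of a * FreeGroup.mk ((a, false) :: L) := by
        rw [FreeGroup.of, FreeGroup.mul_mk]
        exact (Quot.sound (FreeGroup.Red.Step.not (L₁ := []) (b := true))).symm
      rw [hcons] at ih' hL
      rw [map_mul, hmul _ ha _ hsL hL, FreeGroup.lift_apply_of] at ih'
      exact mul_left_cancel ih'

theorem isTablePresentation_norm_le {G : Type*} [Group G] {φ : FreeGroup α →* G}
    (hφ : Function.Surjective φ) {R : Set (FreeGroup α)} (hR : Subgroup.normalClosure R = φ.ker)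
    {n : ℕ} (hn : 1 ≤ n) (hRn : ∀ r ∈ R, r.norm ≤ n) :
    IsTablePresentation.{w} {x | x.norm ≤ n} φ where
  closure_image := by
    rw [← MonoidHom.map_closure, eq_top_iff, ← Subgroup.map_top_of_surjective φ hφ,
      ← FreeGroup.closure_range_of α]
    refine Subgroup.map_mono (Subgroup.closure_mono ?_)
    rintro _ ⟨a, rfl⟩
    simpa using hn
  exists_hom {K} _ f hker hmul := by
    have hlift {x : FreeGroup α} (hx : x.norm ≤ n) : FreeGroup.lift (fun a => f (.of a)) x = f x :=
      freeGroup_lift_eq_of_norm_le hn hmul hx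
    have hle : φ.ker ≤ (FreeGroup.lift fun a => f (.of a)).ker := by
      rw [← hR]
      refine Subgroup.normalClosure_le_normal fun r hr => ?_
      have hφr : φ r = 1 := by
        rw [← MonoidHom.mem_ker, ← hR]
        exact Subgroup.subset_normalClosure hr
      exact (hlift (hRn r hr)).trans (hker r (hRn r hr) hφr)
    exact ⟨φ.liftOfSurjective hφ ⟨_, hle⟩, fun x hx =>
      (φ.liftOfRightInverse_comp_apply _ _ ⟨_, hle⟩ x).trans (hlift hx)⟩

end WordBall

theorem exists_isTablePresentation (G : Type*) [Group G] [Group.IsFinitelyPresented G] :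
    ∃ (n : ℕ) (π : FreeGroup (Fin n) →* G) (T : Set (FreeGroup (Fin n))), T.Finite ∧
      IsTablePresentation.{w} T π := by
  obtain ⟨m, π, hπ, R, hRfin, hR⟩ := Group.IsFinitelyPresented.out (G := G)
  obtain ⟨n, hn⟩ := (hRfin.image FreeGroup.norm).bddAbove
  exact ⟨m, π, {x | x.norm ≤ n + 1}, finite_norm_le _,
    isTablePresentation_norm_le hπ hR (Nat.le_add_left 1 n) fun r hr =>
      (hn ⟨r, hr, rfl⟩).trans (Nat.le_succ n)⟩

theorem IsTablePresentation.comp_evalMonoidHom {ι : Type*} [DecidableEq ι] {Γ : ι → Type*}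
    [∀ i, Group (Γ i)] {T : ∀ i, Set (Γ i)} {i : ι} {H : Type*} [Group H]
    {π : Γ i →* H} (h : IsTablePresentation.{w} (T i) π) :
    IsTablePresentation.{w} (insert 1 (⋃ j, Pi.mulSingle j '' T j))
      (π.comp (Pi.evalMonoidHom Γ i)) where
  closure_image := by
    refine top_unique (h.closure_image ▸ Subgroup.closure_mono ?_)
    rintro _ ⟨x, hx, rfl⟩
    exact ⟨Pi.mulSingle i x, .inr (Set.mem_iUnion.2 ⟨i, x, hx, rfl⟩), by simp⟩
  exists_hom {K} _ f hker hmul := by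
    have mem (j : ι) {x : Γ j} (hx : x ∈ T j) :
        Pi.mulSingle j x ∈ insert 1 (⋃ j, Pi.mulSingle j '' T j) :=
      .inr (Set.mem_iUnion.2 ⟨j, x, hx, rfl⟩)
    have map_one : f 1 = 1 := hker 1 (.inl rfl) (by simp)
    obtain ⟨F, hF⟩ := h.exists_hom (fun x => f (Pi.mulSingle i x))
      (fun x hx hπx => hker _ (mem i hx) (by simpa using hπx)) fun x hx y hy hxy => by
        rw [Pi.mulSingle_mul]
        exact hmul _ (mem i hx) _ (mem i hy) (Pi.mulSingle_mul i x y ▸ mem i hxy)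
    refine ⟨F, ?_⟩
    rintro _ (rfl | hx)
    · rw [map_one, _root_.map_one, _root_.map_one]
    obtain ⟨j, x, hxj, rfl⟩ := Set.mem_iUnion.1 hx
    obtain rfl | hij := eq_or_ne i j
    · simpa using hF x hxj
    · rw [hker _ (mem j hxj) (by simp [hij]), MonoidHom.comp_apply, Pi.evalMonoidHom_apply,
        Pi.mulSingle_eq_of_ne hij, _root_.map_one, _root_.map_one]

/-! ### Basic and connected algebras -/

theorem jacobson_eq_ker_of_isNilpotent {A B : Type*} [Ring A] [Ring B] [IsSemisimpleRing B]
    {f : A →+* B} (hf : Function.Surjective f) (hnil : ∀ x ∈ RingHom.ker f, IsNilpotent x) :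
    Ring.jacobson A = RingHom.ker f := by
  refine le_antisymm (fun x hx => ?_) fun x hx => ?_
  · have : RingHomSurjective f := ⟨hf⟩
    have hfx := Ring.le_comap_jacobson f hx
    rwa [IsSemisimpleRing.jacobson_eq_bot] at hfx
  · rw [← Ideal.jacobson_bot, Ideal.mem_jacobson_iff]
    intro y
    obtain ⟨u, hu⟩ := (hnil (y * x) (Ideal.mul_mem_left _ y hx)).isUnit_one_add
    refine ⟨↑u⁻¹, ?_⟩
    rw [Ideal.mem_bot, mul_assoc, ← mul_add_one, add_comm, ← hu, u.inv_mul, sub_self]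

theorem isBasicAlgebra_of_isNilpotent {k : Type u} [Field k] {A : Type*} [Ring A] [Algebra k A]
    {r : ℕ} {f : A →ₐ[k] (Fin r → k)} (hf : Function.Surjective f)
    (hnil : ∀ x, f x = 0 → IsNilpotent x) : IsBasicAlgebra k A :=
  ⟨r, ⟨(Ideal.quotientEquivAlgOfEq k
    (jacobson_eq_ker_of_isNilpotent (f := f.toRingHom) hf hnil)).trans
      (Ideal.quotientKerAlgEquivOfSurjective hf)⟩⟩

theorem isConnectedAlgebra_of_isCentral (k : Type u) [Field k] (A : Type*) [Ring A] [Algebra k A]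
    [Nontrivial A] [Algebra.IsCentral k A] : IsConnectedAlgebra A where
  nontrivial := inferInstance
  eq_zero_or_one e he hc := by
    obtain ⟨r, rfl⟩ := Algebra.mem_bot.1 (Algebra.IsCentral.out (Subalgebra.mem_center_iff.2
      fun a => (hc a).symm) : e ∈ (⊥ : Subalgebra k A))
    rw [← map_mul, (algebraMap k A).injective.eq_iff] at he
    exact (IsIdempotentElem.iff_eq_zero_or_one.1 he).imp (by rintro rfl; simp) (by rintro rfl; simp)

/-! ### The algebra of a bilinear map -/

/-- The algebra of upper triangular `3 × 3` matrices with diagonal entries in `k`, entries in `M`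
and `N` next to the diagonal and an entry in `P` in the corner, multiplied by means of the bilinear
map `μ : M × N → P`. -/
@[ext]
structure BilinearAlgebra {k M N P : Type*} [Field k] [AddCommGroup M] [AddCommGroup N]
    [AddCommGroup P] [Module k M] [Module k N] [Module k P] (μ : M →ₗ[k] N →ₗ[k] P) where
  diag : Fin 3 → k
  left : M
  right : N
  corner : P

namespace BilinearAlgebra

variable {k M N P : Type*} [Field k] [AddCommGroup M] [AddCommGroup N] [AddCommGroup P]
  [Module k M] [Module k N] [Module k P] {μ : M →ₗ[k] N →ₗ[k] P}

variable (μ) in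
/-- The entries of an element, used to transport the linear structure. -/
def equivProd : BilinearAlgebra μ ≃ (Fin 3 → k) × M × N × P where
  toFun x := (x.diag, x.left, x.right, x.corner)
  invFun x := ⟨x.1, x.2.1, x.2.2.1, x.2.2.2⟩

instance : AddCommGroup (BilinearAlgebra μ) := (equivProd μ).addCommGroup

instance : Module k (BilinearAlgebra μ) := (equivProd μ).module k

variable (μ) in
/-- The entries of an element, as a linear equivalence. -/
def linearEquivProd : BilinearAlgebra μ ≃ₗ[k] (Fin 3 → k) × M × N × P :=
  (equivProd μ).linearEquiv k

instance [Module.Finite k M] [Module.Finite k N] [Module.Finite k P] :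
    Module.Finite k (BilinearAlgebra μ) :=
  Module.Finite.equiv (linearEquivProd μ).symm

instance : Mul (BilinearAlgebra μ) where
  mul x y :=
    { diag := x.diag * y.diag
      left := x.diag 0 • y.left + y.diag 1 • x.left
      right := x.diag 1 • y.right + y.diag 2 • x.right
      corner := x.diag 0 • y.corner + μ x.left y.right + y.diag 2 • x.corner }

instance : One (BilinearAlgebra μ) := ⟨⟨1, 0, 0, 0⟩⟩

section Entries

variable (x y : BilinearAlgebra μ) (r : k)

@[simp] theorem diag_add : (x + y).diag = x.diag + y.diag := rfl
@[simp] theorem left_add : (x + y).left = x.left + y.left := rfl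
@[simp] theorem right_add : (x + y).right = x.right + y.right := rfl
@[simp] theorem corner_add : (x + y).corner = x.corner + y.corner := rfl
@[simp] theorem diag_zero : (0 : BilinearAlgebra μ).diag = 0 := rfl
@[simp] theorem left_zero : (0 : BilinearAlgebra μ).left = 0 := rfl
@[simp] theorem right_zero : (0 : BilinearAlgebra μ).right = 0 := rfl
@[simp] theorem corner_zero : (0 : BilinearAlgebra μ).corner = 0 := rfl
@[simp] theorem diag_one : (1 : BilinearAlgebra μ).diag = 1 := rfl
@[simp] theorem left_one : (1 : BilinearAlgebra μ).left = 0 := rfl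
@[simp] theorem right_one : (1 : BilinearAlgebra μ).right = 0 := rfl
@[simp] theorem corner_one : (1 : BilinearAlgebra μ).corner = 0 := rfl
@[simp] theorem diag_smul : (r • x).diag = r • x.diag := rfl
@[simp] theorem left_smul : (r • x).left = r • x.left := rfl
@[simp] theorem right_smul : (r • x).right = r • x.right := rfl
@[simp] theorem corner_smul : (r • x).corner = r • x.corner := rfl
@[simp] theorem diag_mul : (x * y).diag = x.diag * y.diag := rfl
@[simp] theorem left_mul : (x * y).left = x.diag 0 • y.left + y.diag 1 • x.left := rfl
@[simp] theorem right_mul : (x * y).right = x.diag 1 • y.right + y.diag 2 • x.right := rfl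
@[simp] theorem corner_mul :
    (x * y).corner = x.diag 0 • y.corner + μ x.left y.right + y.diag 2 • x.corner := rfl

end Entries

instance : Ring (BilinearAlgebra μ) :=
  { (inferInstance : AddCommGroup (BilinearAlgebra μ)) with
    mul := (· * ·)
    one := 1
    mul_assoc := fun x y z => by
      ext1
      · simp [mul_assoc]
      all_goals simp; module
    one_mul := fun x => by ext1 <;> simp
    mul_one := fun x => by ext1 <;> simp
    left_distrib := fun x y z => by
      ext1
      · simp [mul_add]
      all_goals simp; module
    right_distrib := fun x y z => by
      ext1
      · simp [add_mul]
      all_goals simp; module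
    zero_mul := fun x => by ext1 <;> simp
    mul_zero := fun x => by ext1 <;> simp }

instance : Algebra k (BilinearAlgebra μ) :=
  Algebra.ofModule (fun r x y => by ext1 <;> simp <;> module)
    (fun r x y => by ext1 <;> simp <;> module)

variable (μ) in
/-- The projection to the diagonal. -/
def diagHom : BilinearAlgebra μ →ₐ[k] (Fin 3 → k) :=
  AlgHom.ofLinearMap (LinearMap.fst k _ _ ∘ₗ (linearEquivProd μ).toLinearMap) rfl fun _ _ => rfl

theorem mul_mul_eq_zero {x y z : BilinearAlgebra μ} (hx : x.diag = 0) (hy : y.diag = 0)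
    (hz : z.diag = 0) : x * y * z = 0 := by
  ext1 <;> simp [hx, hy, hz]

theorem isBasicAlgebra : IsBasicAlgebra k (BilinearAlgebra μ) :=
  isBasicAlgebra_of_isNilpotent (f := diagHom μ) (fun d => ⟨⟨d, 0, 0, 0⟩, rfl⟩) fun x hx =>
    ⟨3, by rw [pow_succ, pow_two, mul_mul_eq_zero hx hx hx]⟩

instance : Nontrivial (BilinearAlgebra μ) :=
  ⟨0, 1, fun h => by simpa using congrFun (congrArg diag h) 0⟩

instance [Nontrivial M] [Nontrivial N] : Algebra.IsCentral k (BilinearAlgebra μ) where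
  out z hz := by
    have comm (x : BilinearAlgebra μ) : z * x = x * z := (Subalgebra.mem_center_iff.1 hz x).symm
    obtain ⟨m, hm⟩ := exists_ne (0 : M)
    obtain ⟨n, hn⟩ := exists_ne (0 : N)
    have diag_zero_eq : z.diag 0 = z.diag 1 := by
      simpa [smul_left_inj hm] using congrArg left (comm ⟨0, m, 0, 0⟩)
    have diag_one_eq : z.diag 1 = z.diag 2 := by
      simpa [smul_left_inj hn] using congrArg right (comm ⟨0, 0, n, 0⟩)
    have comm_first := comm ⟨Pi.single 0 1, 0, 0, 0⟩
    refine Algebra.mem_bot.2 ⟨z.diag 1, ?_⟩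
    rw [Algebra.algebraMap_eq_smul_one]
    ext1
    · ext i
      fin_cases i <;> simp [diag_zero_eq, diag_one_eq]
    · simpa using congrArg left comm_first
    · simpa using (congrArg right (comm ⟨Pi.single 2 1, 0, 0, 0⟩)).symm
    · simpa using congrArg corner comm_first

variable (μ) in
/-- The inclusion of the diagonal matrices. -/
def ofDiag : (Fin 3 → k) →ₐ[k] BilinearAlgebra μ :=
  AlgHom.ofLinearMap ((linearEquivProd μ).symm.toLinearMap ∘ₗ LinearMap.inl k _ _) rfl
    fun d d' => by
      change (⟨d * d', 0, 0, 0⟩ : BilinearAlgebra μ) = ⟨d, 0, 0, 0⟩ * ⟨d', 0, 0, 0⟩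
      ext1 <;> simp

variable (μ) in
/-- The inclusion of the left off-diagonal entries. -/
def ofLeft : M →ₗ[k] BilinearAlgebra μ :=
  (linearEquivProd μ).symm.toLinearMap ∘ₗ LinearMap.inr k _ _ ∘ₗ LinearMap.inl k _ _

variable (μ) in
/-- The inclusion of the right off-diagonal entries. -/
def ofRight : N →ₗ[k] BilinearAlgebra μ :=
  (linearEquivProd μ).symm.toLinearMap ∘ₗ LinearMap.inr k _ _ ∘ₗ LinearMap.inr k _ _ ∘ₗ
    LinearMap.inl k _ _

variable (μ) in
/-- The inclusion of the corner entries. -/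
def ofCorner : P →ₗ[k] BilinearAlgebra μ :=
  (linearEquivProd μ).symm.toLinearMap ∘ₗ LinearMap.inr k _ _ ∘ₗ LinearMap.inr k _ _ ∘ₗ
    LinearMap.inr k _ _

@[simp] theorem mk_zero : (⟨0, 0, 0, 0⟩ : BilinearAlgebra μ) = 0 := rfl

section Inclusions

variable (d : Fin 3 → k) (m : M) (n : N) (p : P)

@[simp] theorem ofDiag_apply : ofDiag μ d = ⟨d, 0, 0, 0⟩ := rfl
@[simp] theorem ofLeft_apply : ofLeft μ m = ⟨0, m, 0, 0⟩ := rfl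
@[simp] theorem ofRight_apply : ofRight μ n = ⟨0, 0, n, 0⟩ := rfl
@[simp] theorem ofCorner_apply : ofCorner μ p = ⟨0, 0, 0, p⟩ := rfl

end Inclusions

/-- The linear map with prescribed restrictions to the four kinds of entries. -/
def elim {Q : Type*} [AddCommGroup Q] [Module k Q] (fd : (Fin 3 → k) →ₗ[k] Q) (fl : M →ₗ[k] Q)
    (fr : N →ₗ[k] Q) (fc : P →ₗ[k] Q) : BilinearAlgebra μ →ₗ[k] Q :=
  fd.coprod (fl.coprod (fr.coprod fc)) ∘ₗ (linearEquivProd μ).toLinearMap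

@[simp] theorem elim_apply {Q : Type*} [AddCommGroup Q] [Module k Q] (fd : (Fin 3 → k) →ₗ[k] Q)
    (fl : M →ₗ[k] Q) (fr : N →ₗ[k] Q) (fc : P →ₗ[k] Q) (x : BilinearAlgebra μ) :
    elim fd fl fr fc x = fd x.diag + (fl x.left + (fr x.right + fc x.corner)) := rfl

theorem eq_top_of_mem {W : Submodule k (BilinearAlgebra μ)} (hd : ∀ d, ofDiag μ d ∈ W)
    (hl : ∀ m, ofLeft μ m ∈ W) (hr : ∀ n, ofRight μ n ∈ W) (hc : ∀ p, ofCorner μ p ∈ W) :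
    W = ⊤ := by
  refine Submodule.eq_top_iff'.2 fun x => ?_
  have entries :
      x = ofDiag μ x.diag + ofLeft μ x.left + ofRight μ x.right + ofCorner μ x.corner := by
    ext1 <;> simp
  rw [entries]
  exact W.add_mem (W.add_mem (W.add_mem (hd _) (hl _)) (hr _)) (hc _)

end BilinearAlgebra

/-! ### Morphisms out of a path algebra -/

/-- The values on stationary paths and on arrows of a morphism from a path algebra to `B`: a
complete system of orthogonal idempotents indexed by the vertices and, for each arrow, an element of
the corresponding Peirce component. -/
structure ArrowSystem (V : Type v) [Quiver.{w} V] [Fintype V] (B : Type*) [Ring B] where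
  vertex : V → B
  arrow : ∀ {a b : V}, (a ⟶ b) → B
  complete : CompleteOrthogonalIdempotents vertex
  vertex_mul_arrow : ∀ {a b : V} (α : a ⟶ b), vertex a * arrow α = arrow α
  arrow_mul_vertex : ∀ {a b : V} (α : a ⟶ b), arrow α * vertex b = arrow α

namespace ArrowSystem

variable {V : Type v} [Quiver.{w} V] [Fintype V] {B : Type*} [Ring B] (S : ArrowSystem V B)

/-- The image of a path. -/
def value {a b : V} (p : Quiver.Path a b) : B := S.vertex a * p.weight S.arrow

theorem value_nil (a : V) : S.value (Quiver.Path.nil : Quiver.Path a a) = S.vertex a := by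
  rw [value, Quiver.Path.weight_nil, mul_one]

theorem value_toPath {a b : V} (α : a ⟶ b) : S.value α.toPath = S.arrow α := by
  rw [value, Quiver.Hom.toPath, Quiver.Path.weight_cons, Quiver.Path.weight_nil, one_mul,
    S.vertex_mul_arrow]

theorem vertex_mul_value {a b : V} (p : Quiver.Path a b) : S.vertex a * S.value p = S.value p := by
  rw [value, ← mul_assoc, (S.complete.idem a).eq]

theorem value_mul_vertex {a b : V} (p : Quiver.Path a b) : S.value p * S.vertex b = S.value p := by
  cases p with
  | nil => rw [value_nil, (S.complete.idem a).eq]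
  | cons p α => rw [value, Quiver.Path.weight_cons, mul_assoc, mul_assoc, S.arrow_mul_vertex]

theorem value_comp {a b c : V} (p : Quiver.Path a b) (q : Quiver.Path b c) :
    S.value (p.comp q) = S.value p * S.value q :=
  calc S.value (p.comp q) = S.value p * q.weight S.arrow := by
        rw [value, Quiver.Path.weight_comp, ← mul_assoc, value]
    _ = S.value p * S.vertex b * q.weight S.arrow := by rw [S.value_mul_vertex]
    _ = S.value p * S.value q := mul_assoc _ _ _

theorem value_mul_value_of_ne {a b c d : V} (p : Quiver.Path a b) (q : Quiver.Path c d)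
    (h : c ≠ b) : S.value p * S.value q = 0 := by
  rw [← S.value_mul_vertex p, ← S.vertex_mul_value q, mul_assoc, ← mul_assoc (S.vertex b),
    S.complete.ortho h.symm, zero_mul, mul_zero]

end ArrowSystem

namespace PathAlgebra

variable {k : Type u} [Field k] {V : Type v} [Quiver.{w} V] [Fintype V]

section Lift

variable {B : Type*} [Ring B] [Algebra k B] (S : ArrowSystem V B)

variable (k) in
/-- The linear map given on paths by `ArrowSystem.value`. -/
def liftLinear : PathAlgebra k V →ₗ[k] B := (basis k V).constr k fun p => S.value p.2.2

theorem liftLinear_ofPath {a b : V} (p : Quiver.Path a b) :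
    liftLinear k S (ofPath k p) = S.value p := by
  rw [liftLinear, ofPath, Module.Basis.constr_basis]

theorem liftLinear_mul (x y : PathAlgebra k V) :
    liftLinear k S (x * y) = liftLinear k S x * liftLinear k S y := by
  have bilinear_eq : (mulMap k (V := V)).compr₂ (liftLinear k S) =
      (LinearMap.mul k B).compl₁₂ (liftLinear k S) (liftLinear k S) := by
    refine hom_ext fun a b p => hom_ext fun c d q => ?_
    change liftLinear k S (ofPath k p * ofPath k q) =
      liftLinear k S (ofPath k p) * liftLinear k S (ofPath k q)
    rw [liftLinear_ofPath, liftLinear_ofPath]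
    by_cases h : c = b
    · subst h
      rw [ofPath_mul_ofPath, liftLinear_ofPath, S.value_comp]
    · rw [ofPath_mul_ofPath_of_ne _ _ h, map_zero, S.value_mul_value_of_ne _ _ h]
  exact LinearMap.congr_fun₂ bilinear_eq x y

variable (k) in
/-- The morphism with prescribed values on stationary paths and on arrows. -/
def lift : PathAlgebra k V →ₐ[k] B :=
  AlgHom.ofLinearMap (liftLinear k S)
    (by simp only [one_def, map_sum, liftLinear_ofPath, S.value_nil, S.complete.complete])
    (liftLinear_mul S)

theorem lift_ofPath {a b : V} (p : Quiver.Path a b) : lift k S (ofPath k p) = S.value p :=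
  liftLinear_ofPath S p

end Lift

section ArrowIdeal

variable {B : Type*} [Ring B] [Algebra k B]

theorem ofPath_toPath_mem_arrowIdeal {a b : V} (α : a ⟶ b) :
    ofPath k α.toPath ∈ arrowIdeal k V :=
  TwoSidedIdeal.mem_asIdeal.2 (TwoSidedIdeal.subset_span ⟨a, b, α, rfl⟩)

theorem arrowIdeal_le_ker {f : PathAlgebra k V →ₐ[k] B}
    (h : ∀ {a b : V} (α : a ⟶ b), f (ofPath k α.toPath) = 0) :
    arrowIdeal k V ≤ RingHom.ker f := by
  have span_le : TwoSidedIdeal.span {x | ∃ (a b : V) (α : a ⟶ b), x = ofPath k α.toPath} ≤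
      TwoSidedIdeal.ker f := by
    rw [TwoSidedIdeal.span_le]
    rintro _ ⟨a, b, α, rfl⟩
    exact (TwoSidedIdeal.mem_ker f).2 (h α)
  exact fun x hx => (TwoSidedIdeal.mem_ker f).1 (span_le (TwoSidedIdeal.mem_asIdeal.1 hx))

theorem ker_le_of_sub_mem {f : PathAlgebra k V →ₐ[k] B} {I : Ideal (PathAlgebra k V)}
    (σ : B →ₗ[k] PathAlgebra k V)
    (h : ∀ {a b : V} (p : Quiver.Path a b), ofPath k p - σ (f (ofPath k p)) ∈ I) :
    RingHom.ker f ≤ I := by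
  have sub_mem : (I.restrictScalars k).comap (LinearMap.id - σ ∘ₗ f.toLinearMap) = ⊤ :=
    (Submodule.eq_top_iff_forall_basis_mem (basis k V)).2 fun ⟨_, _, p⟩ => h p
  intro x hx
  have : x - σ (f x) ∈ I := Submodule.eq_top_iff'.1 sub_mem x
  rwa [(RingHom.mem_ker).1 hx, map_zero, sub_zero] at this

end ArrowIdeal

end PathAlgebra

namespace BilinearAlgebra

variable {k M N P : Type*} [Field k] [AddCommGroup M] [AddCommGroup N] [AddCommGroup P]
  [Module k M] [Module k N] [Module k P] {μ : M →ₗ[k] N →ₗ[k] P}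

theorem pow_three_le_ker {R : Type*} [Ring R] {f : R →+* BilinearAlgebra μ} {I : Ideal R}
    (h : ∀ x ∈ I, (f x).diag = 0) : I ^ 3 ≤ RingHom.ker f := by
  have mul_eq_zero_of_mem_sq {x y : R} (hx : x ∈ I ^ 2) (hy : y ∈ I) : f x * f y = 0 := by
    rw [Submodule.pow_succ, Submodule.pow_one] at hx
    induction hx using Submodule.mul_induction_on' with
    | mem_mul_mem a ha b hb => rw [map_mul, mul_mul_eq_zero (h a ha) (h b hb) (h y hy)]
    | add a _ b _ ha hb => rw [map_add, add_mul, ha, hb, add_zero]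
  rw [Submodule.pow_succ, Ideal.mul_le]
  intro x hx y hy
  rw [RingHom.mem_ker, map_mul, mul_eq_zero_of_mem_sq hx hy]

end BilinearAlgebra

/-! ### The two-step quiver -/

/-- The vertices of the quiver with arrows `source ⟶ middle` labelled by `α` and arrows
`middle ⟶ target` labelled by `β`. The labels occur in the type of the vertices because this type
carries the quiver instance. -/
inductive TwoStep (α : Type v) (β : Type w) : Type
  | source
  | middle
  | target

namespace TwoStep

variable {α : Type v} {β : Type w}

/-- The numbering of the vertices. -/
def toFin : TwoStep α β ≃ Fin 3 where
  toFun a := match a with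
    | source => 0
    | middle => 1
    | target => 2
  invFun := ![source, middle, target]
  left_inv := by rintro (_ | _ | _) <;> rfl
  right_inv i := by fin_cases i <;> rfl

@[simp] theorem toFin_source : toFin (source : TwoStep α β) = 0 := rfl
@[simp] theorem toFin_middle : toFin (middle : TwoStep α β) = 1 := rfl
@[simp] theorem toFin_target : toFin (target : TwoStep α β) = 2 := rfl

instance : Fintype (TwoStep α β) := Fintype.ofEquiv _ toFin.symm

/-- The arrows of the two-step quiver. -/
inductive Arrow (α : Type v) (β : Type w) : TwoStep α β → TwoStep α β → Type (max v w)
  | fst (s : α) : Arrow α β source middle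
  | snd (t : β) : Arrow α β middle target

instance : Quiver (TwoStep α β) := ⟨Arrow α β⟩

/-- An arrow of the first step. -/
abbrev fst (s : α) : (source : TwoStep α β) ⟶ middle := Arrow.fst s

/-- An arrow of the second step. -/
abbrev snd (t : β) : (middle : TwoStep α β) ⟶ target := Arrow.snd t

/-- A path of length two. -/
abbrev long (s : α) (t : β) : Quiver.Path (source : TwoStep α β) target :=
  (fst s).toPath.cons (snd t)

theorem path_cases {motive : ∀ {a b : TwoStep α β}, Quiver.Path a b → Prop}
    (nil : ∀ a : TwoStep α β, motive (Quiver.Path.nil : Quiver.Path a a))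
    (fst : ∀ s : α, motive (fst s).toPath) (snd : ∀ t : β, motive (snd t).toPath)
    (long : ∀ (s : α) (t : β), motive (long s t)) {a b : TwoStep α β} (p : Quiver.Path a b) :
    motive p := by
  rcases p with _ | ⟨p, ⟨s⟩ | ⟨t⟩⟩
  · exact nil a
  · rcases p with _ | ⟨p, ⟨⟩⟩
    exact fst s
  · rcases p with _ | ⟨p, ⟨s⟩ | ⟨⟩⟩
    · exact snd t
    · rcases p with _ | ⟨p, ⟨⟩⟩
      exact long s t

theorem exists_eq_long (p : Quiver.Path (source : TwoStep α β) target) : ∃ s t, p = long s t := by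
  rcases p with _ | ⟨p, ⟨⟩ | ⟨t⟩⟩
  rcases p with _ | ⟨p, ⟨s⟩ | ⟨⟩⟩
  rcases p with _ | ⟨p, ⟨⟩⟩
  exact ⟨s, t, rfl⟩

theorem long_inj {s s' : α} {t t' : β} : long s t = long s' t' ↔ s = s' ∧ t = t' := by
  refine ⟨fun h => ?_, by rintro ⟨rfl, rfl⟩; rfl⟩
  cases h
  exact ⟨rfl, rfl⟩

theorem isAcyclicQuiver : IsAcyclicQuiver (TwoStep α β) := by
  intro a p
  rcases p with _ | ⟨p, ⟨s⟩ | ⟨t⟩⟩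
  · rfl
  · rcases p with _ | ⟨p, ⟨⟩⟩
  · rcases p with _ | ⟨p, ⟨s⟩ | ⟨⟩⟩
    rcases p with _ | ⟨p, ⟨⟩⟩

/-- The walk from the source to another vertex along the arrows with given labels. -/
def treeWalk (s : α) (t : β) : ∀ a : TwoStep α β,
    QuiverWalk (Quiver.symVertex (source : TwoStep α β)) (Quiver.symVertex a)
  | source => .nil
  | middle => (fst s).toPath.toWalk
  | target => (long s t).toWalk

theorem isFiniteConnectedQuiver [Finite α] [Finite β] [Nonempty α] [Nonempty β] :
    IsFiniteConnectedQuiver (TwoStep α β) where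
  finite_hom a b := by
    refine Finite.of_injective (β := α ⊕ β)
      (fun e : Arrow α β a b => match e with | .fst s => .inl s | .snd t => .inr t) ?_
    rintro (_ | _) ⟨⟩ <;> grind
  nonempty := ⟨source⟩
  connected a b :=
    let walk := treeWalk (Classical.arbitrary α) (Classical.arbitrary β)
    ⟨(walk a).reverse.comp (walk b)⟩

end TwoStep

/-! ### Presentations of the algebra of a bilinear map -/

namespace TwoStep

open BilinearAlgebra PathAlgebra

variable {α : Type v} {β : Type w} {k M N P : Type*} [Field k] [AddCommGroup M] [AddCommGroup N]
  [AddCommGroup P] [Module k M] [Module k N] [Module k P] (μ : M →ₗ[k] N →ₗ[k] P)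
  (bM : Module.Basis α k M) (bN : Module.Basis β k N)

variable (k α β) in
/-- The diagonal idempotents, indexed by the vertices. -/
def vertexBasis : Module.Basis (TwoStep α β) k (Fin 3 → k) :=
  (Pi.basisFun k (Fin 3)).reindex toFin.symm

theorem vertexBasis_apply (a : TwoStep α β) : vertexBasis α β k a = Pi.single (toFin a) 1 := by
  simp [vertexBasis]

theorem completeOrthogonalIdempotents_vertexBasis :
    CompleteOrthogonalIdempotents (vertexBasis α β k) := by
  convert (CompleteOrthogonalIdempotents.equiv toFin).2
    (CompleteOrthogonalIdempotents.single fun _ : Fin 3 => k)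
  ext1 a
  exact vertexBasis_apply a

/-- The vertices act by the diagonal idempotents and the arrows by the basis vectors. -/
def arrowSystem : ArrowSystem (TwoStep α β) (BilinearAlgebra μ) where
  vertex a := ofDiag μ (vertexBasis α β k a)
  arrow e := match e with
    | .fst s => ofLeft μ (bM s)
    | .snd t => ofRight μ (bN t)
  complete := completeOrthogonalIdempotents_vertexBasis.map (ofDiag μ).toRingHom
  vertex_mul_arrow := by rintro _ _ (s | t) <;> ext1 <;> simp [vertexBasis_apply]
  arrow_mul_vertex := by rintro _ _ (s | t) <;> ext1 <;> simp [vertexBasis_apply]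

/-- The morphism from the path algebra of the two-step quiver that sends the arrows to basis
vectors of `M` and `N`. -/
def basisHom : PathAlgebra k (TwoStep α β) →ₐ[k] BilinearAlgebra μ :=
  lift k (arrowSystem μ bM bN)

theorem basisHom_nil (a : TwoStep α β) :
    basisHom μ bM bN (ofPath k (Quiver.Path.nil : Quiver.Path a a)) =
      ofDiag μ (vertexBasis α β k a) :=
  (lift_ofPath _ _).trans (ArrowSystem.value_nil _ a)

theorem basisHom_fst (s : α) : basisHom μ bM bN (ofPath k (fst s).toPath) = ofLeft μ (bM s) :=
  (lift_ofPath _ _).trans (ArrowSystem.value_toPath _ (fst s))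

theorem basisHom_snd (t : β) : basisHom μ bM bN (ofPath k (snd t).toPath) = ofRight μ (bN t) :=
  (lift_ofPath _ _).trans (ArrowSystem.value_toPath _ (snd t))

theorem basisHom_long (s : α) (t : β) :
    basisHom μ bM bN (ofPath k (long s t)) = ofCorner μ (μ (bM s) (bN t)) := by
  rw [long, ← Quiver.Path.comp_toPath_eq_cons, ← ofPath_mul_ofPath, map_mul, basisHom_fst,
    basisHom_snd]
  ext1 <;> simp

variable {μ} in
theorem basisHom_surjective (hμ : Submodule.map₂ μ ⊤ ⊤ = ⊤) :
    Function.Surjective (basisHom μ bM bN) := by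
  let W := (basisHom μ bM bN).toLinearMap.range
  have diag_mem : W.comap (ofDiag μ).toLinearMap = ⊤ :=
    (Submodule.eq_top_iff_forall_basis_mem (vertexBasis α β k)).2 fun a =>
      ⟨_, basisHom_nil μ bM bN a⟩
  have left_mem : W.comap (ofLeft μ) = ⊤ :=
    (Submodule.eq_top_iff_forall_basis_mem bM).2 fun s => ⟨_, basisHom_fst μ bM bN s⟩
  have right_mem : W.comap (ofRight μ) = ⊤ :=
    (Submodule.eq_top_iff_forall_basis_mem bN).2 fun t => ⟨_, basisHom_snd μ bM bN t⟩
  have corner_mem : W.comap (ofCorner μ) = ⊤ := by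
    rw [eq_top_iff, ← hμ, ← bM.span_eq, ← bN.span_eq, Submodule.map₂_span_span, Submodule.span_le]
    rintro _ ⟨_, ⟨s, rfl⟩, _, ⟨t, rfl⟩, rfl⟩
    exact ⟨_, basisHom_long μ bM bN s t⟩
  exact LinearMap.range_eq_top.1 (eq_top_of_mem (Submodule.eq_top_iff'.1 diag_mem)
    (Submodule.eq_top_iff'.1 left_mem) (Submodule.eq_top_iff'.1 right_mem)
    (Submodule.eq_top_iff'.1 corner_mem))

theorem diag_basisHom_of_mem_arrowIdeal {x : PathAlgebra k (TwoStep α β)}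
    (hx : x ∈ arrowIdeal k (TwoStep α β)) : (basisHom μ bM bN x).diag = 0 := by
  refine arrowIdeal_le_ker (f := (diagHom μ).comp (basisHom μ bM bN)) ?_ hx
  rintro _ _ (s | t)
  · exact congrArg diag (basisHom_fst μ bM bN s)
  · exact congrArg diag (basisHom_snd μ bM bN t)

theorem ker_basisHom_le : RingHom.ker (basisHom μ bM bN) ≤ arrowIdeal k (TwoStep α β) ^ 2 := by
  refine ker_le_of_sub_mem (elim
    ((vertexBasis α β k).constr k fun a => ofPath k (Quiver.Path.nil : Quiver.Path a a))
    (bM.constr k fun s => ofPath k (fst s).toPath) (bN.constr k fun t => ofPath k (snd t).toPath) 0)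
    fun p => ?_
  induction p using path_cases with
  | nil a => simp [basisHom_nil, -Module.Basis.constr_apply_fintype]
  | fst s => simp [basisHom_fst]
  | snd t => simp [basisHom_snd]
  | long s t =>
    rw [basisHom_long, long, ← Quiver.Path.comp_toPath_eq_cons, ← ofPath_mul_ofPath,
      Submodule.pow_succ, Submodule.pow_one]
    simpa using Submodule.mul_mem_mul
      (ofPath_toPath_mem_arrowIdeal (fst s)) (ofPath_toPath_mem_arrowIdeal (snd t))

variable {μ} in
theorem isPresentation_basisHom (hμ : Submodule.map₂ μ ⊤ ⊤ = ⊤) :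
    IsPresentation (basisHom μ bM bN) where
  surjective := basisHom_surjective bM bN hμ
  admissible :=
    { isTwoSided := inferInstance
      exists_pow_le := ⟨3, by norm_num, pow_three_le_ker (f := (basisHom μ bM bN).toRingHom)
        fun _ => diag_basisHom_of_mem_arrowIdeal μ bM bN⟩
      le_sq := ker_basisHom_le μ bM bN }

include bM bN in
variable {μ} in
theorem isTriangularAlgebra [Finite α] [Finite β] [Nonempty α] [Nonempty β] [Module.Finite k P]
    (hμ : Submodule.map₂ μ ⊤ ⊤ = ⊤) :
    IsTriangularAlgebra k (BilinearAlgebra μ) (TwoStep α β) :=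
  have := Module.Finite.of_basis bM
  have := Module.Finite.of_basis bN
  have := nontrivial_of_ne _ _ (bM.ne_zero (Classical.arbitrary α))
  have := nontrivial_of_ne _ _ (bN.ne_zero (Classical.arbitrary β))
  { finiteDimensional := inferInstance
    basic := isBasicAlgebra
    connected := isConnectedAlgebra_of_isCentral k _
    quiver := isFiniteConnectedQuiver
    acyclic := isAcyclicQuiver
    exists_presentation := ⟨_, isPresentation_basisHom bM bN hμ⟩ }

end TwoStep

/-! ### Weights of walks -/

/-- The weight of a walk with values in a group: the product of the weights of its arrows and of
the inverse weights of its formal inverses of arrows. -/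
def walkWeight {V : Type v} [Quiver.{w} V] {H : Type*} [Group H]
    (d : ∀ {a b : V}, (a ⟶ b) → H) {x y : Quiver.Symmetrify V} (p : QuiverWalk x y) : H :=
  p.weight fun e => Sum.elim d (fun α => (d α)⁻¹) e

section WalkWeight

variable {V : Type v} [Quiver.{w} V] {H : Type*} [Group H] (d : ∀ {a b : V}, (a ⟶ b) → H)

theorem walkWeight_nil (x : Quiver.Symmetrify V) : walkWeight @d (.nil : QuiverWalk x x) = 1 :=
  Quiver.Path.weight_nil _ x

theorem walkWeight_comp {x y z : Quiver.Symmetrify V} (p : QuiverWalk x y) (q : QuiverWalk y z) :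
    walkWeight @d (p.comp q) = walkWeight @d p * walkWeight @d q :=
  Quiver.Path.weight_comp _ p q

theorem walkWeight_cons {x y z : Quiver.Symmetrify V} (p : QuiverWalk x y) (e : y ⟶ z) :
    walkWeight @d (p.cons e) = walkWeight @d p * Sum.elim d (fun α => (d α)⁻¹) e :=
  Quiver.Path.weight_cons _ p e

theorem walkWeight_toWalk {x y : V} (p : Quiver.Path x y) :
    walkWeight @d p.toWalk = p.weight d := by
  induction p with
  | nil => exact (walkWeight_nil @d _).trans (Quiver.Path.weight_nil _ _).symm
  | cons p α ih =>
    rw [Quiver.Path.weight_cons, ← ih]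
    exact walkWeight_cons @d p.toWalk (Sum.inl α)

theorem walkWeight_reverse {x y : Quiver.Symmetrify V} (p : QuiverWalk x y) :
    walkWeight @d p.reverse = (walkWeight @d p)⁻¹ := by
  induction p with
  | nil => simp [Quiver.Path.reverse, walkWeight_nil]
  | cons p e ih =>
    rw [Quiver.Path.reverse, walkWeight_comp, ih, walkWeight_cons, mul_inv_rev, Quiver.Hom.toPath,
      walkWeight_cons, walkWeight_nil, one_mul]
    congr 1
    rcases e with α | α
    · rfl
    · exact (inv_inv (d α)).symm

variable {k : Type u} [Field k] [Fintype V] {I : Ideal (PathAlgebra k V)}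

variable {d} in
theorem WalkHomotopic.walkWeight_eq
    (hI : ∀ {x y : V} {c : Quiver.Path x y →₀ k}, PathAlgebra.IsMinimalRelation I c →
      ∀ p ∈ c.support, ∀ q ∈ c.support, p.weight d = q.weight d)
    {x y : Quiver.Symmetrify V} {p q : QuiverWalk x y} (h : WalkHomotopic I p q) :
    walkWeight @d p = walkWeight @d q := by
  induction h with
  | refl => rfl
  | symm _ ih => exact ih.symm
  | trans _ _ ih ih' => exact ih.trans ih'
  | arrow_inv α =>
    have h := walkWeight_comp @d α.toPath.toWalk α.toPath.toWalk.reverse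
    rw [walkWeight_reverse, mul_inv_cancel] at h
    exact h.trans (walkWeight_nil @d _).symm
  | inv_arrow α =>
    have h := walkWeight_comp @d α.toPath.toWalk.reverse α.toPath.toWalk
    rw [walkWeight_reverse, inv_mul_cancel] at h
    exact h.trans (walkWeight_nil @d _).symm
  | minimal c hc p q hp hq =>
    rw [walkWeight_toWalk, walkWeight_toWalk]
    exact hI hc p hp q hq
  | comp s t _ ih => simp only [walkWeight_comp, ih]

end WalkWeight

/-! ### Minimal relations -/

namespace PathAlgebra

variable {k : Type u} {V : Type v} [Field k] [Quiver.{w} V] [Fintype V]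

/-- The map `Φ` plays the role of a decomposition of `A` into homogeneous components: it makes the
kernel of `f` homogeneous, and a minimal relation has only one homogeneous component. -/
theorem IsMinimalRelation.degree_eq {A D : Type*} [Ring A] [Algebra k A]
    {f : PathAlgebra k V →ₐ[k] A} {deg : ∀ {x y : V}, Quiver.Path x y → D}
    (Φ : A →ₗ[k] (D →₀ A))
    (hΦ : ∀ {x y : V} (p : Quiver.Path x y),
      Φ (f (ofPath k p)) = Finsupp.single (deg p) (f (ofPath k p)))
    {x y : V} {c : Quiver.Path x y →₀ k} (hc : IsMinimalRelation (RingHom.ker f) c)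
    {p q : Quiver.Path x y} (hp : p ∈ c.support) (hq : q ∈ c.support) : deg p = deg q := by
  classical
  by_contra hne
  refine hc.notMem {w ∈ c.support | deg w = deg p}
    (Finset.filter_ssubset.2 ⟨q, hq, fun h => hne h.symm⟩) ⟨p, Finset.mem_filter.2 ⟨hp, rfl⟩⟩ ?_
  have component : Φ (f (∑ w ∈ c.support, c w • ofPath k w)) (deg p) =
      f (∑ w ∈ c.support with deg w = deg p, c w • ofPath k w) := by
    simp only [map_sum, map_smul, hΦ, Finsupp.finsetSum_apply, Finsupp.smul_apply,
      Finsupp.single_apply, Finset.sum_filter, smul_ite, smul_zero,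
      apply_ite f, map_zero]
  rw [RingHom.mem_ker, ← component, (RingHom.mem_ker).1 hc.mem, map_zero, Finsupp.zero_apply]

theorem isMinimalRelation_of_card_le_three {I : Ideal (PathAlgebra k V)} {x y : V}
    (hI : ∀ p : Quiver.Path x y, ofPath k p ∉ I) {c : Quiver.Path x y →₀ k}
    (h₂ : 2 ≤ c.support.card) (h₃ : c.support.card ≤ 3)
    (hc : ∑ w ∈ c.support, c w • ofPath k w ∈ I) : IsMinimalRelation I c := by
  classical
  have sum_notMem : ∀ J ⊆ c.support, J.card = 1 → ∑ w ∈ J, c w • ofPath k w ∉ I := by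
    intro J hJ hcard hmem
    obtain ⟨w, rfl⟩ := Finset.card_eq_one.1 hcard
    have hw : c w ≠ 0 := Finsupp.mem_support_iff.1 (hJ (Finset.mem_singleton_self w))
    rw [Finset.sum_singleton] at hmem
    exact hI w ((I.restrictScalars k).smul_mem_iff hw |>.1 hmem)
  refine ⟨h₂, hc, fun J hJ hne hmem => ?_⟩
  have hlt := Finset.card_lt_card hJ
  have hpos := hne.card_pos
  obtain hJ₁ | hJ₂ : J.card = 1 ∨ J.card = 2 := by omega
  · exact sum_notMem J hJ.1 hJ₁ hmem
  · refine sum_notMem (c.support \ J) Finset.sdiff_subset ?_ ?_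
    · rw [Finset.card_sdiff_of_subset hJ.1]
      omega
    · rw [← Finset.sum_sdiff hJ.1] at hc
      exact (Submodule.add_mem_iff_left _ hmem).1 hc

/-- The coefficient `l` may vanish, in which case the relation has only two terms. -/
theorem exists_isMinimalRelation_of_three_term {I : Ideal (PathAlgebra k V)} {x y : V}
    (hI : ∀ p : Quiver.Path x y, ofPath k p ∉ I) {p q r : Quiver.Path x y} (hpq : p ≠ q)
    (hpr : p ≠ r) (hqr : q ≠ r) {l : k} (h : ofPath k p - ofPath k q - l • ofPath k r ∈ I) :
    ∃ c : Quiver.Path x y →₀ k, IsMinimalRelation I c ∧ p ∈ c.support ∧ q ∈ c.support ∧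
      (l ≠ 0 → r ∈ c.support) := by
  classical
  let c := Finsupp.single p 1 - Finsupp.single q 1 - Finsupp.single r l
  have hp : p ∈ c.support := by simp [c, hpq.symm, hpr.symm]
  have hq : q ∈ c.support := by simp [c, hpq, hqr.symm]
  have hr : l ≠ 0 → r ∈ c.support := by simp [c, hpr, hqr]
  have hsub : c.support ⊆ {p, q, r} := by
    refine Finsupp.support_sub.trans (Finset.union_subset (Finsupp.support_sub.trans
      (Finset.union_subset ?_ ?_)) ?_) <;> refine Finsupp.support_single_subset.trans ?_ <;> simp
  refine ⟨c, isMinimalRelation_of_card_le_three hI ?_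
    ((Finset.card_le_card hsub).trans Finset.card_le_three) ?_, hp, hq, hr⟩
  · exact Finset.one_lt_card.2 ⟨p, hp, q, hq, hpq⟩
  · have : Finsupp.linearCombination k (ofPath k) c ∈ I := by simpa [c] using h
    exact this

end PathAlgebra

theorem WalkHomotopic.of_three_term {k : Type u} {V : Type v} [Field k] [Quiver.{w} V] [Fintype V]
    {I : Ideal (PathAlgebra k V)} {x y : V}
    (hI : ∀ p : Quiver.Path x y, PathAlgebra.ofPath k p ∉ I) {p q r : Quiver.Path x y}
    (hpq : p ≠ q) (hpr : p ≠ r) (hqr : q ≠ r) {l : k}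
    (h : PathAlgebra.ofPath k p - PathAlgebra.ofPath k q - l • PathAlgebra.ofPath k r ∈ I) :
    WalkHomotopic I p.toWalk q.toWalk ∧ (l ≠ 0 → WalkHomotopic I p.toWalk r.toWalk) := by
  obtain ⟨c, hc, hp, hq, hr⟩ :=
    PathAlgebra.exists_isMinimalRelation_of_three_term hI hpq hpr hqr h
  exact ⟨.minimal c hc p q hp hq, fun hl => .minimal c hc p r hp (hr hl)⟩

/-! ### Based classes of walks -/

/-- The class in the fundamental group at `x` of a walk, closed up by means of chosen walks from `x`
to all vertices. -/
def basedClass {k : Type u} {V : Type v} [Field k] [Quiver.{w} V] [Fintype V]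
    (I : Ideal (PathAlgebra k V)) {x : V}
    (T : ∀ y : Quiver.Symmetrify V, QuiverWalk (Quiver.symVertex x) y) {y z : Quiver.Symmetrify V}
    (p : QuiverWalk y z) : QuiverFundamentalGroup I x :=
  Quotient.mk _ (((T y).comp p).comp (T z).reverse)

section BasedClass

variable {k : Type u} {V : Type v} [Field k] [Quiver.{w} V] [Fintype V]
  {I : Ideal (PathAlgebra k V)} {x : V}
  (T : ∀ y : Quiver.Symmetrify V, QuiverWalk (Quiver.symVertex x) y)

theorem basedClass_congr {y z : Quiver.Symmetrify V} {p q : QuiverWalk y z}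
    (h : WalkHomotopic I p q) : basedClass I T p = basedClass I T q :=
  Quotient.sound (WalkHomotopic.comp _ _ h)

theorem basedClass_comp {y z t : Quiver.Symmetrify V} (p : QuiverWalk y z) (q : QuiverWalk z t) :
    basedClass I T (p.comp q) = basedClass I T p * basedClass I T q := by
  refine (Quotient.sound ?_ : _ = Quotient.mk _ ((((T y).comp p).comp (T z).reverse).comp
    (((T z).comp q).comp (T t).reverse)))
  have h := WalkHomotopic.comp ((T y).comp p) (q.comp (T t).reverse)
    (WalkHomotopic.reverse_comp (I := I) (T z))
  simp only [Quiver.Path.comp_nil, Quiver.Path.comp_assoc] at h ⊢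
  exact h.symm

theorem basedClass_eq_one {y z : Quiver.Symmetrify V} {p : QuiverWalk y z}
    (h : (T y).comp p = T z) : basedClass I T p = 1 := by
  refine Quotient.sound ?_
  rw [h]
  exact WalkHomotopic.comp_reverse _

theorem basedClass_toNeg {a b : V} (α : a ⟶ b) :
    basedClass I T (Quiver.Hom.toPath (V := Quiver.Symmetrify V) α.toNeg) =
      (basedClass I T α.toPath.toWalk)⁻¹ := by
  refine eq_inv_of_mul_eq_one_left ((basedClass_comp T _ _).symm.trans ?_)
  exact (basedClass_congr T (.inv_arrow α)).trans (basedClass_eq_one T rfl)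

theorem basedClass_of_homotopic_nil (hT : WalkHomotopic I (T (Quiver.symVertex x)) .nil)
    (p : QuiverWalk (Quiver.symVertex x) (Quiver.symVertex x)) :
    basedClass I T p = Quotient.mk _ p := by
  refine Quotient.sound ?_
  have h := WalkHomotopic.comp_congr (hT.comp_right p) hT.reverse_congr
  rwa [Quiver.Path.nil_comp] at h

variable {H : Type*} [Group H] {d : ∀ {a b : V}, (a ⟶ b) → H}
  {F : H →* QuiverFundamentalGroup I x}

theorem map_walkWeight_eq_basedClass
    (hF : ∀ {a b : V} (α : a ⟶ b), F (d α) = basedClass I T α.toPath.toWalk)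
    {y z : Quiver.Symmetrify V} (p : QuiverWalk y z) :
    F (walkWeight @d p) = basedClass I T p := by
  induction p with
  | nil => rw [walkWeight_nil, map_one, basedClass_eq_one T rfl]
  | cons p e ih =>
    rw [walkWeight_cons, map_mul, ih, ← Quiver.Path.comp_toPath_eq_cons, basedClass_comp]
    congr 1
    rcases e with α | α
    · exact hF α
    · exact (map_inv F _).trans ((congrArg _ (hF α)).trans (basedClass_toNeg T α).symm)

variable {T}

/-- The weight of walks and the homomorphism `F` are inverse to each other. -/
theorem QuiverFundamentalGroup.nonempty_mulEquiv
    (hT : WalkHomotopic I (T (Quiver.symVertex x)) .nil) (hTd : ∀ y, walkWeight @d (T y) = 1)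
    (hd : ∀ {y z : Quiver.Symmetrify V} {p q : QuiverWalk y z},
      WalkHomotopic I p q → walkWeight @d p = walkWeight @d q)
    (hgen : Subgroup.closure {h | ∃ (a b : V) (α : a ⟶ b), d α = h} = ⊤)
    (hF : ∀ {a b : V} (α : a ⟶ b), F (d α) = basedClass I T α.toPath.toWalk) :
    Nonempty (QuiverFundamentalGroup I x ≃* H) := by
  let D : QuiverFundamentalGroup I x →* H :=
    MonoidHom.mk' (Quotient.lift (fun p => walkWeight @d p) fun _ _ h => hd h) (by
      rintro ⟨p⟩ ⟨q⟩
      exact walkWeight_comp @d p q)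
  refine ⟨D.toMulEquiv F ?_ (MonoidHom.eq_of_eqOn_dense hgen ?_)⟩
  · ext ⟨p⟩
    exact (map_walkWeight_eq_basedClass T hF p).trans (basedClass_of_homotopic_nil T hT p)
  · rintro _ ⟨a, b, α, rfl⟩
    rw [MonoidHom.comp_apply, hF]
    change walkWeight @d (((T _).comp _).comp (T _).reverse) = d α
    simp [walkWeight_comp, walkWeight_reverse, hTd, walkWeight_toWalk, Quiver.Hom.toPath]

end BasedClass

/-! ### Homogeneity of the presentations -/

namespace TwoStep

open BilinearAlgebra PathAlgebra

section Homogeneity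

variable {α : Type v} {β : Type w} {H : Type*}

/-- The weights of the arrows with given values on the labels. -/
def arrowWeight (γ : α → H) (γ' : β → H) : ∀ {a b : TwoStep α β}, (a ⟶ b) → H
  | _, _, .fst s => γ s
  | _, _, .snd t => γ' t

variable [Group H] (γ : α → H) (γ' : β → H)

theorem weight_fst (s : α) : (fst s).toPath.weight (arrowWeight γ γ') = γ s := by
  simp [Quiver.Hom.toPath, arrowWeight]

theorem weight_snd (t : β) : (snd t).toPath.weight (arrowWeight γ γ') = γ' t := by
  simp [Quiver.Hom.toPath, arrowWeight]

theorem weight_long (s : α) (t : β) :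
    (long s t).weight (arrowWeight γ γ') = γ s * γ' t := by
  rw [long, Quiver.Path.weight_cons, weight_fst, arrowWeight]

theorem walkWeight_treeWalk {s : α} {t : β} (hs : γ s = 1) (ht : γ' t = 1) (a : TwoStep α β) :
    walkWeight (arrowWeight γ γ') (treeWalk s t a) = 1 := by
  rcases a with _ | _ | _
  · exact walkWeight_nil _ _
  · exact (walkWeight_toWalk _ _).trans ((weight_fst γ γ' s).trans hs)
  · exact (walkWeight_toWalk _ _).trans ((weight_long γ γ' s t).trans (by rw [hs, ht, one_mul]))

variable {γ γ'} {k M N P : Type*} [Field k] [AddCommGroup M] [AddCommGroup N] [AddCommGroup P]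
  [Module k M] [Module k N] [Module k P] {μ : M →ₗ[k] N →ₗ[k] P}
  {bM : Module.Basis α k M} {bN : Module.Basis β k N}

theorem walkWeight_eq_of_walkHomotopic (δ : P →ₗ[k] (H →₀ P))
    (hδ : ∀ s t, δ (μ (bM s) (bN t)) = Finsupp.single (γ s * γ' t) (μ (bM s) (bN t)))
    {x y : Quiver.Symmetrify (TwoStep α β)} {p q : QuiverWalk x y}
    (h : WalkHomotopic (RingHom.ker (basisHom μ bM bN)) p q) :
    walkWeight (arrowWeight γ γ') p = walkWeight (arrowWeight γ γ') q := by
  refine h.walkWeight_eq fun hc p hp q hq => hc.degree_eq (elim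
    (Finsupp.lsingle 1 ∘ₗ (ofDiag μ).toLinearMap)
    (bM.constr k fun s => Finsupp.single (γ s) (ofLeft μ (bM s)))
    (bN.constr k fun t => Finsupp.single (γ' t) (ofRight μ (bN t)))
    (Finsupp.mapRange.linearMap (ofCorner μ) ∘ₗ δ)) (fun p => ?_) hp hq
  induction p using path_cases with
  | nil a => simp [basisHom_nil, -Module.Basis.constr_apply_fintype]
  | fst s => simp [basisHom_fst, weight_fst, -Module.Basis.constr_apply_fintype]
  | snd t => simp [basisHom_snd, weight_snd, -Module.Basis.constr_apply_fintype]
  | long s t =>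
    simp [basisHom_long, weight_fst, arrowWeight, hδ, -Module.Basis.constr_apply_fintype]

end Homogeneity

/-! ### The algebra of a table -/

section Table

variable {α : Type v} {β : Type w} {ι k : Type*} [Field k]

variable (k) in
/-- The bilinear map given on basis vectors by the table `κ`. -/
def tableMap (κ : α → β → ι) : (α →₀ k) →ₗ[k] (β →₀ k) →ₗ[k] (ι →₀ k) :=
  Finsupp.linearCombination k fun s => Finsupp.lmapDomain k k (κ s)

variable {κ : α → β → ι}

theorem tableMap_single (s : α) (t : β) (a b : k) :
    tableMap k κ (Finsupp.single s a) (Finsupp.single t b) = Finsupp.single (κ s t) (a * b) := by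
  simp [tableMap, Finsupp.mapDomain_single]

theorem map₂_tableMap (hκ : ∀ c, ∃ s t, κ s t = c) :
    Submodule.map₂ (tableMap k κ) ⊤ ⊤ = ⊤ := by
  refine (Submodule.eq_top_iff_forall_basis_mem Finsupp.basisSingleOne).2 fun c => ?_
  obtain ⟨s, t, rfl⟩ := hκ c
  simpa [tableMap_single] using Submodule.apply_mem_map₂ (tableMap k κ)
    (Submodule.mem_top (x := Finsupp.single s 1)) (Submodule.mem_top (x := Finsupp.single t 1))

variable {o : α} {l : α → k} (hl : l o = 0)

/-- The basis of the vectors `e s + l s • e o`. -/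
def shearBasis : Module.Basis α k (α →₀ k) :=
  Finsupp.basisSingleOne.map (LinearEquiv.transvection (f := Finsupp.linearCombination k l)
    (v := Finsupp.single o 1) (by simp [hl]))

theorem shearBasis_apply (s : α) :
    shearBasis hl s = Finsupp.single s 1 + Finsupp.single o (l s) := by
  simp [shearBasis, LinearMap.transvection.apply]

variable (κ) in
/-- The presentation of the algebra of the table `κ` in which the arrow `fst s` is sent to
`e s + l s • e o`. -/
def tableHom : PathAlgebra k (TwoStep α β) →ₐ[k] BilinearAlgebra (tableMap k κ) :=
  basisHom (tableMap k κ) (shearBasis hl) Finsupp.basisSingleOne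

theorem tableMap_shearBasis (s : α) (t : β) :
    tableMap k κ (shearBasis hl s) (Finsupp.single t 1) =
      Finsupp.single (κ s t) 1 + Finsupp.single (κ o t) (l s) := by
  simp [shearBasis_apply, tableMap_single]

theorem tableHom_long (s : α) (t : β) :
    tableHom κ hl (ofPath k (long s t)) =
      ofCorner _ (Finsupp.single (κ s t) 1 + Finsupp.single (κ o t) (l s)) := by
  rw [tableHom, basisHom_long, Finsupp.coe_basisSingleOne, tableMap_shearBasis]

variable {hl}

theorem walkWeight_eq_of_walkHomotopic_tableHom {H : Type*} [Group H] {γ : α → H} {γ' : β → H}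
    (ε : ι → H) (hε : ∀ s t, ε (κ s t) = γ s * γ' t) (hlγ : ∀ s, l s ≠ 0 → γ s = γ o)
    {x y : Quiver.Symmetrify (TwoStep α β)} {p q : QuiverWalk x y}
    (h : WalkHomotopic (RingHom.ker (tableHom κ hl)) p q) :
    walkWeight (arrowWeight γ γ') p = walkWeight (arrowWeight γ γ') q := by
  refine walkWeight_eq_of_walkHomotopic
    (Finsupp.linearCombination k fun c => Finsupp.single (ε c) (Finsupp.single c 1))
    (fun s t => ?_) h
  rw [Finsupp.coe_basisSingleOne, tableMap_shearBasis]
  by_cases hs : l s = 0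
  · simp [hs, hε]
  · simp [hε, hlγ s hs]

variable (hκ : ∀ s t, κ s t = κ o t → s = o)

include hκ in
theorem ofPath_notMem_ker_tableHom (p : Quiver.Path (source : TwoStep α β) target) :
    ofPath k p ∉ RingHom.ker (tableHom κ hl) := by
  classical
  obtain ⟨s, t, rfl⟩ := exists_eq_long p
  intro hmem
  rw [RingHom.mem_ker, tableHom_long] at hmem
  have coeff := DFunLike.congr_fun (congrArg corner hmem) (κ s t)
  by_cases hs : κ o t = κ s t
  · obtain rfl := hκ s t hs.symm
    simp [hl] at coeff
  · simp [Ne.symm hs] at coeff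

include hκ in
theorem walkHomotopic_long {s : α} (hs : s ≠ o) {t r : β} (h : κ s t = κ o r) :
    WalkHomotopic (RingHom.ker (tableHom κ hl)) (long s t).toWalk (long o r).toWalk ∧
      (l s ≠ 0 → WalkHomotopic (RingHom.ker (tableHom κ hl)) (long s t).toWalk
        (long o t).toWalk) := by
  have hrt : r ≠ t := by
    rintro rfl
    exact hs (hκ s r h)
  refine WalkHomotopic.of_three_term (ofPath_notMem_ker_tableHom hκ)
    (fun e => hs (long_inj.1 e).1) (fun e => hs (long_inj.1 e).1) (fun e => hrt (long_inj.1 e).2) ?_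
  rw [RingHom.mem_ker, map_sub, map_sub, map_smul, tableHom_long, tableHom_long, tableHom_long,
    ← map_smul, ← map_sub, ← map_sub]
  simp [h, hl]

end Table

end TwoStep

/-! ### The multiplication table of a subset of a group -/

namespace IsTablePresentation

open TwoStep PathAlgebra
open scoped Pointwise

variable {k : Type u} [Field k] {Γ : Type v} [Group Γ] {T : Set Γ} {H : Type w} [Group H]
  {π : Γ →* H}

variable (T) in
/-- The multiplication of the elements of `T`. -/
def table (s t : T) : ↥(T * T) := ⟨s * t, Set.mul_mem_mul s.2 t.2⟩

theorem exists_table_eq (c : ↥(T * T)) : ∃ s t, table T s t = c := by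
  obtain ⟨_, s, hs, t, ht, rfl⟩ := c
  exact ⟨⟨s, hs⟩, ⟨t, ht⟩, rfl⟩

variable (h1 : (1 : Γ) ∈ T)

theorem eq_one_of_table_eq {s t : T} (h : table T s t = table T ⟨1, h1⟩ t) : s = ⟨1, h1⟩ :=
  Subtype.ext (mul_right_cancel (congrArg Subtype.val h))

variable (k π) in
open Classical in
/-- The coefficients of the shear that kills in the fundamental group the nontrivial elements of
the kernel of `π`. -/
def shear (t : T) : k := if π t = 1 ∧ (t : Γ) ≠ 1 then 1 else 0

theorem shear_one : shear k π ⟨1, h1⟩ = 0 := by simp [shear]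

theorem shear_ne_zero {t : T} : shear k π t ≠ 0 ↔ π t = 1 ∧ (t : Γ) ≠ 1 := by simp [shear]

variable (k π) in
/-- The presentation of the algebra of the multiplication table of `T` attached to `π`. -/
def groupHom : PathAlgebra k (TwoStep T T) →ₐ[k] BilinearAlgebra (tableMap k (table T)) :=
  tableHom (table T) (shear_one (k := k) (π := π) h1)

theorem isPresentation_groupHom : IsPresentation (groupHom k π h1) :=
  isPresentation_basisHom _ _ (map₂_tableMap exists_table_eq)

include h1 in
theorem isTriangularAlgebra (hT : T.Finite) :
    IsTriangularAlgebra k (BilinearAlgebra (tableMap k (table T))) (TwoStep T T) :=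
  have := hT.to_subtype
  have := (hT.mul hT).to_subtype
  have : Nonempty T := ⟨⟨1, h1⟩⟩
  TwoStep.isTriangularAlgebra Finsupp.basisSingleOne Finsupp.basisSingleOne
    (map₂_tableMap exists_table_eq)

section FundamentalGroup

variable (k π) (x : TwoStep T T)

/-- The walks from `x` to all vertices along the arrows labelled by `1`. -/
def tree (y : Quiver.Symmetrify (TwoStep T T)) : QuiverWalk (Quiver.symVertex x) y :=
  (treeWalk ⟨1, h1⟩ ⟨1, h1⟩ x).reverse.comp (treeWalk ⟨1, h1⟩ ⟨1, h1⟩ y)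

/-- The based class of an arrow of the first step. -/
def fstClass (s : T) : QuiverFundamentalGroup (RingHom.ker (groupHom k π h1)) x :=
  basedClass _ (tree h1 x) (fst s).toPath.toWalk

/-- The based class of an arrow of the second step. -/
def sndClass (t : T) : QuiverFundamentalGroup (RingHom.ker (groupHom k π h1)) x :=
  basedClass _ (tree h1 x) (snd t).toPath.toWalk

theorem fstClass_one : fstClass k π h1 x ⟨1, h1⟩ = 1 := basedClass_eq_one _ rfl

theorem sndClass_one : sndClass k π h1 x ⟨1, h1⟩ = 1 := basedClass_eq_one _ rfl

theorem basedClass_long (s t : T) :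
    basedClass (RingHom.ker (groupHom k π h1)) (tree h1 x) (long s t).toWalk =
      fstClass k π h1 x s * sndClass k π h1 x t :=
  basedClass_comp _ (fst s).toPath.toWalk (snd t).toPath.toWalk

theorem fstClass_mul_sndClass_congr {s t s' t' : T}
    (h : WalkHomotopic (RingHom.ker (groupHom k π h1)) (long s t).toWalk (long s' t').toWalk) :
    fstClass k π h1 x s * sndClass k π h1 x t = fstClass k π h1 x s' * sndClass k π h1 x t' := by
  rw [← basedClass_long, ← basedClass_long]
  exact basedClass_congr _ h

theorem fstClass_mul_sndClass {s t r : T} (h : (s * t : Γ) = r) :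
    fstClass k π h1 x s * sndClass k π h1 x t = sndClass k π h1 x r := by
  by_cases hs : s = ⟨1, h1⟩
  · obtain rfl : t = r := Subtype.ext (by rw [← h, hs, one_mul])
    rw [hs, fstClass_one, one_mul]
  · have htable : table T s t = table T ⟨1, h1⟩ r := Subtype.ext (h.trans (one_mul _).symm)
    rw [fstClass_mul_sndClass_congr k π h1 x
      (walkHomotopic_long (fun _ _ => eq_one_of_table_eq h1) hs htable).1, fstClass_one, one_mul]

theorem fstClass_eq_sndClass (t : T) : fstClass k π h1 x t = sndClass k π h1 x t := by
  simpa only [sndClass_one, mul_one] using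
    fstClass_mul_sndClass k π h1 x (t := ⟨1, h1⟩) (mul_one (t : Γ))

theorem fstClass_eq_one {t : T} (ht : π t = 1) : fstClass k π h1 x t = 1 := by
  by_cases ht₁ : t = ⟨1, h1⟩
  · rw [ht₁, fstClass_one]
  · have htable : table T t ⟨1, h1⟩ = table T ⟨1, h1⟩ t :=
      Subtype.ext ((mul_one _).trans (one_mul _).symm)
    have hshear : shear k π t ≠ 0 := shear_ne_zero.2 ⟨ht, fun h => ht₁ (Subtype.ext h)⟩
    have := fstClass_mul_sndClass_congr k π h1 x
      ((walkHomotopic_long (fun _ _ => eq_one_of_table_eq h1) ht₁ htable).2 hshear)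
    rwa [sndClass_one, fstClass_one, mul_one, mul_one] at this

variable {π}

theorem exists_hom_eq_fstClass (hπ : IsTablePresentation.{v} T π) :
    ∃ F : H →* QuiverFundamentalGroup (RingHom.ker (groupHom k π h1)) x,
      ∀ t : T, F (π t) = fstClass k π h1 x t := by
  let f : Γ → QuiverFundamentalGroup (RingHom.ker (groupHom k π h1)) x :=
    Function.extend Subtype.val (fstClass k π h1 x) 1
  have hf (t : T) : f t = fstClass k π h1 x t := Subtype.val_injective.extend_apply _ _ t
  obtain ⟨F, hF⟩ := hπ.exists_hom f
    (fun s hs hπs => (hf ⟨s, hs⟩).trans (fstClass_eq_one k π h1 x hπs))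
    fun s hs t ht hst => by
      rw [hf ⟨s, hs⟩, hf ⟨t, ht⟩, hf ⟨s * t, hst⟩, fstClass_eq_sndClass k π h1 x ⟨t, ht⟩,
        fstClass_eq_sndClass k π h1 x ⟨s * t, hst⟩, 
        fstClass_mul_sndClass k π h1 x (r := ⟨s * t, hst⟩) rfl]
  exact ⟨F, fun t => (hF t t.2).trans (hf t)⟩

theorem nonempty_mulEquiv (hπ : IsTablePresentation.{v} T π) :
    Nonempty (QuiverFundamentalGroup (RingHom.ker (groupHom k π h1)) x ≃* H) := by
  let γ (t : T) : H := π t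
  have walkWeight_treeWalk (y : TwoStep T T) :
      walkWeight (arrowWeight γ γ) (treeWalk ⟨1, h1⟩ ⟨1, h1⟩ y) = 1 :=
    TwoStep.walkWeight_treeWalk γ γ (map_one π) (map_one π) y
  have walkWeight_tree (y : TwoStep T T) : walkWeight (arrowWeight γ γ) (tree h1 x y) = 1 := by
    refine (walkWeight_comp _ _ _).trans (mul_eq_one_iff_eq_inv.2 ?_)
    rw [walkWeight_reverse]
    exact congrArg _ ((walkWeight_treeWalk x).trans (walkWeight_treeWalk y).symm)
  obtain ⟨F, hF⟩ := exists_hom_eq_fstClass k h1 x hπ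
  refine QuiverFundamentalGroup.nonempty_mulEquiv (T := tree h1 x) (d := arrowWeight γ γ) (F := F)
    (WalkHomotopic.reverse_comp _) walkWeight_tree ?_ ?_ ?_
  · exact walkWeight_eq_of_walkHomotopic_tableHom (γ := γ) (γ' := γ) (fun c : ↥(T * T) => π c)
      (fun s t => map_mul π (s : Γ) t) (fun s hs => (shear_ne_zero.1 hs).1.trans (map_one π).symm)
  · refine top_unique (hπ.closure_image ▸ Subgroup.closure_mono ?_)
    rintro _ ⟨t, ht, rfl⟩
    exact ⟨source, middle, fst ⟨t, ht⟩, rfl⟩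
  · rintro _ _ (t | t)
    · exact hF t
    · exact (hF t).trans (fstClass_eq_sndClass k π h1 x t)

end FundamentalGroup

end IsTablePresentation

theorem theoremB_general (k : Type u) [Field k] {ι : Type} [Finite ι] (G : ι → Type v)
    [∀ i, Group (G i)] [∀ i, Group.IsFinitelyPresented (G i)] :
    ∃ (V : Type) (_ : Fintype V) (_ : Quiver.{0} V) (A : Type u) (_ : Ring A) (_ : Algebra k A)
      (ν : ι → (PathAlgebra k V →ₐ[k] A)),
      IsTriangularAlgebra k A V ∧
        ∀ i, IsPresentation (ν i) ∧
          ∀ x : V, Nonempty (QuiverFundamentalGroup (RingHom.ker (ν i)) x ≃* G i) := by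
  classical
  choose m π T hT hπ using fun i => exists_isTablePresentation.{0} (G i)
  let S : Set (∀ i, FreeGroup (Fin (m i))) := insert 1 (⋃ j, Pi.mulSingle j '' T j)
  have hS : S.Finite := (Set.finite_iUnion fun j => (hT j).image _).insert 1
  have h1 : 1 ∈ S := Set.mem_insert _ _
  exact ⟨_, inferInstance, inferInstance, _, inferInstance, inferInstance,
    fun i => IsTablePresentation.groupHom k ((π i).comp (Pi.evalMonoidHom _ i)) h1,
    IsTablePresentation.isTriangularAlgebra h1 hS,
    fun i => ⟨IsTablePresentation.isPresentation_groupHom h1,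
      fun x => IsTablePresentation.nonempty_mulEquiv k h1 x (hπ i).comp_evalMonoidHom⟩⟩

end

theorem theoremB (k : Type u) [Field k] [IsAlgClosed k] (n : ℕ) (G : Fin n → Type v)
    [∀ i, Group (G i)] (hG : ∀ i, CyclicProductClass (G i)) :
    ∃ (V : Type) (_ : Fintype V) (_ : Quiver.{0} V) (A : Type u) (_ : Ring A) (_ : Algebra k A)
      (ν : Fin n → (PathAlgebra k V →ₐ[k] A)),
      IsTriangularAlgebra k A V ∧
      ∀ i, IsPresentation (ν i) ∧
        ∀ x : V, Nonempty (QuiverFundamentalGroup (RingHom.ker (ν i)) x ≃* G i) := by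
  have (i : Fin n) := (hG i).isFinitelyPresented
  exact theoremB_general k G
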